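/- **Lemma 2.1 (weighted Trudinger–Moser inequality).** Let $\Omega=\mathbb R^2$, or let $\Omega=\mathbb T^2=(\mathbb R/L\mathbb Z)^2$ be a flat torus of side length $L>0$. There is a constant $C>0$, depending only on $\Omega$, such that the following holds. Let $T>0$, let $p\in L^\infty([0,T];\mathcal P(\Omega)\cap L\log L(\Omega))$, that is, $p$ is a measurable real function on $(0,T)\times\Omega$ such that for almost every $t\in(0,T)$ one has $p(t,\cdot)\ge 0$ almost everywhere and $\int_\Omega p(t,x)\,dx=1$, and $$\sup_{0<t<T}\int_\Omega p\,|\ln p|\,dx<\infty ,$$ where $0\ln 0=0$ and the supremum over $t$ is the essential supremum. Let $\phi\in L^2(0,T;H^1(\Omega))$ take values in $\mathbb R$ or, more generally, in a finite-dimensional real inner product space. Then $$\int_0^T\!\!\int_\Omega p\,|\phi|^2\,dx\,dt\;\le\; C\left(1+\sup_{0<t<T}\int_\Omega p\,|\ln p|\,dx\right)\|\phi\|_{L^2(0,T;H^1(\Omega))}^2 ,$$ where $\|\phi\|_{L^2(0,T;H^1(\Omega))}^2=\int_0^T\!\int_\Omega\left(|\phi|^2+|\nabla\phi|^2\right)dx\,dt$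 and $\nabla\phi$ is the weak gradient of $\phi$ in $x$. In particular the left-hand side is finite. -/

import Mathlib

open MeasureTheory Set
open scoped ENNReal ContDiff

noncomputable section

/-- The plane `ℝ²`, with its Euclidean norm and Lebesgue measure. -/
abbrev Plane : Type := EuclideanSpace ℝ (Fin 2)

/-- The flat torus `(ℝ / Lℤ)²` of side length `L`; its `volume` is the product measure, of total
mass `L ^ 2`. -/
abbrev FlatTorus (L : ℝ) : Type := Fin 2 → AddCircle L

/-- The canonical projection `ℝ² → (ℝ / Lℤ)²`. -/
def torusProj (L : ℝ) : Plane →+ FlatTorus L where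
  toFun y := fun i => ((y i : ℝ) : AddCircle L)
  map_zero' := by
    funext i
    simp
  map_add' y z := by
    funext i
    simp

/-- The trivial projection `ℝ² → ℝ²`. -/
def planeProj : Plane →+ Plane := AddMonoidHom.id Plane

section Sobolev

/- Here `X` is the plane or a flat torus and `τ : ℝ² → X` is the corresponding projection. -/

variable {X : Type} [AddCommGroup X] [TopologicalSpace X] [MeasureSpace X]
variable {V : Type} [NormedAddCommGroup V] [InnerProductSpace ℝ V]

/-- Test functions `η ∈ C_c^∞(X)`: smoothness is smoothness of the lift to `ℝ²`. -/
structure IsTestFunction (τ : Plane →+ X) (η : X → ℝ) : Prop where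
  smooth : ContDiff ℝ ∞ (fun y : Plane => η (τ y))
  compactSupport : HasCompactSupport η

/-- The classical partial derivative `∂ᵢ η` on `X`. -/
def partialDeriv (τ : Plane →+ X) (i : Fin 2) (η : X → ℝ) (x : X) : ℝ :=
  deriv (fun s : ℝ => η (x + τ (EuclideanSpace.single i s))) 0

/-- `g` is the weak partial derivative `∂ᵢ u` on `X`: both are locally integrable and
`∫ (∂ᵢ η) u dx = - ∫ η g dx` for every test function `η`. -/
structure IsWeakPartial (τ : Plane →+ X) (i : Fin 2) (u g : X → V) : Prop where
  locallyIntegrable : LocallyIntegrable u volume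
  locallyIntegrable_deriv : LocallyIntegrable g volume
  integral_eq : ∀ η : X → ℝ, IsTestFunction τ η →
    ∫ x, partialDeriv τ i η x • u x = - ∫ x, η x • g x

/-- The squared norm `‖u‖²_{H¹(X)} = ∫ |u|² dx + ∑ᵢ ∫ |∂ᵢ u|² dx`, with value `∞` when `u` has no
weak gradient. The infimum only serves to name the weak gradient, which is unique up to null
sets. -/
def h1NormSq (τ : Plane →+ X) (u : X → V) : ℝ≥0∞ :=
  ⨅ (g : Fin 2 → X → V) (_ : ∀ i, IsWeakPartial τ i u (g i)),
    ((∫⁻ x, ‖u x‖ₑ ^ 2) + ∑ i, ∫⁻ x, ‖g i x‖ₑ ^ 2)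

/-- The squared norm `‖φ‖²_{L²(0,T;H¹(X))} = ∫₀ᵀ ‖φ(t)‖²_{H¹(X)} dt`. -/
def l2h1NormSq (τ : Plane →+ X) (T : ℝ) (φ : ℝ → X → V) : ℝ≥0∞ :=
  ∫⁻ t in Ioo 0 T, h1NormSq τ (φ t)

/-- `φ ∈ L²(0,T;H¹(X))`. Since `H¹(X)` is separable, (strong) measurability of
`t ↦ φ(t) ∈ H¹(X)` is joint measurability of `φ` and of its weak gradient in `x`. -/
structure MemL2H1 (τ : Plane →+ X) (T : ℝ) (φ : ℝ → X → V) : Prop where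
  aestronglyMeasurable :
    AEStronglyMeasurable (Function.uncurry φ)
      ((volume.restrict (Ioo (0 : ℝ) T)).prod (volume : Measure X))
  exists_gradient : ∃ G : Fin 2 → ℝ → X → V,
    (∀ i, AEStronglyMeasurable (Function.uncurry (G i))
      ((volume.restrict (Ioo (0 : ℝ) T)).prod (volume : Measure X))) ∧
    ∀ᵐ t ∂(volume.restrict (Ioo (0 : ℝ) T)), ∀ i, IsWeakPartial τ i (φ t) (G i t)
  normSq_lt_top : l2h1NormSq τ T φ < ⊤

end Sobolev

section Density

variable {X : Type} [MeasureSpace X]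

/-- The quantity `∫ q |ln q| dx`, with `0 ln 0 = 0`, for a density `q ≥ 0`. -/
def absEntropy (q : X → ℝ) : ℝ≥0∞ :=
  ∫⁻ x, ENNReal.ofReal (q x * |Real.log (q x)|)

/-- `sup_{0 < t < T} ∫ p |ln p| dx`, the supremum over time being the essential one, as `p(t)` is
only determined for almost every `t`. -/
def supAbsEntropy (T : ℝ) (p : ℝ → X → ℝ) : ℝ≥0∞ :=
  essSup (fun t => absEntropy (p t)) (volume.restrict (Ioo (0 : ℝ) T))

/-- `p ∈ L^∞([0,T]; 𝒫(X) ∩ L log L(X))`: `p` is measurable, `p(t)` is a probability density for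
almost every `t`, and `∫ p |ln p| dx` is essentially bounded in time. -/
structure MemLinftyProbLlogL (T : ℝ) (p : ℝ → X → ℝ) : Prop where
  aestronglyMeasurable :
    AEStronglyMeasurable (Function.uncurry p)
      ((volume.restrict (Ioo (0 : ℝ) T)).prod (volume : Measure X))
  nonneg : ∀ᵐ t ∂(volume.restrict (Ioo (0 : ℝ) T)), ∀ᵐ x, 0 ≤ p t x
  mass_eq_one : ∀ᵐ t ∂(volume.restrict (Ioo (0 : ℝ) T)), ∫⁻ x, ENNReal.ofReal (p t x) = 1
  entropy_lt_top : supAbsEntropy T p < ⊤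

end Density

end

/-!
The inequality holds at almost every time separately, and the proof goes through potentials instead
of exponential integrability.

A function `u` with weak gradient `∇u` satisfies `|u| ≤ C k * f` almost everywhere, where
`f = |u| + |∂₁u| + |∂₂u|` and `k(z) = |z|⁻¹` for `|z| ≤ 2` and `k(z) = 0` otherwise
(`exists_enorm_le_lintegral_truncKernel`). To see this, the weak gradient is tested against smooth
vector fields `E_ε(z) = z h_ε(|z|²)` with `|E_ε| ≤ k` whose divergence is a bump of mass `2π`
concentrating at the origin minus a fixed bump; Lebesgue differentiation gives the limit `ε → 0`.

For a probability density `q` it remains to bound `∫ q (k * f)²` by `∫ f²`. By duality and the Schur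
test (`lintegral_mul_sq_kernel_le`) the constant is at most the supremum over `x` of
`∫ q(x') (k * k)(x - x') dx'`. The kernel `k * k` has only a logarithmic singularity,
`k * k ≤ 4π (1 + log (4 / |z|))`, so the duality `st ≤ s ln s + exp (t - 1)` bounds this supremum by
`4π (∫ q |ln q| + 32π)` (`lintegral_mul_truncKernel_sq_le`).

A function on the torus is lifted to the plane. Its lift has the lifted weak gradient, because test
functions can be periodized (`IsWeakPartial.comp_torusProj`). The density is restricted to one
cell, and as `k` has bounded support only finitely many cells contribute.
-/

/-! ### Weighted `L²` bounds for nonnegative kernels -/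

theorem ENNReal.two_mul_mul_le_sq_add_sq (a b : ℝ≥0∞) : 2 * (a * b) ≤ a ^ 2 + b ^ 2 := by
  wlog h : a ≤ b generalizing a b
  · have := this b a (le_of_not_ge h)
    rwa [mul_comm b a, add_comm] at this
  obtain ⟨c, rfl⟩ := exists_add_of_le h
  calc 2 * (a * (a + c)) ≤ 2 * (a * (a + c)) + c ^ 2 := le_self_add
    _ = a ^ 2 + (a + c) ^ 2 := by ring

/-- Young's inequality `2ab ≤ M a² + M⁻¹ b²` in `ℝ≥0∞`. -/
theorem ENNReal.two_mul_mul_le_weighted {M : ℝ≥0∞} (h0 : M ≠ 0) (ht : M ≠ ⊤) (a b : ℝ≥0∞) :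
    2 * (a * b) ≤ M * a ^ 2 + M⁻¹ * b ^ 2 := by
  have hb : b = M * (M⁻¹ * b) := by rw [← mul_assoc, ENNReal.mul_inv_cancel h0 ht, one_mul]
  calc 2 * (a * b) = M * (2 * (a * (M⁻¹ * b))) := by
        conv_lhs => rw [hb]
        ring
    _ ≤ M * (a ^ 2 + (M⁻¹ * b) ^ 2) := by gcongr; exact ENNReal.two_mul_mul_le_sq_add_sq _ _
    _ = M * a ^ 2 + M⁻¹ * b * (M * (M⁻¹ * b)) := by ring
    _ = M * a ^ 2 + M⁻¹ * b ^ 2 := by rw [← hb]; ring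

section Schur

variable {α β : Type*} [MeasurableSpace α] [MeasurableSpace β] {μ : Measure α} {ν : Measure β}
  [SFinite μ] [SFinite ν] {K : α → β → ℝ≥0∞} {q : α → ℝ≥0∞} {M : ℝ≥0∞}

/-- The dual operator `w ↦ ∫ q(x) w(x) K(x, ·) dx` maps `L²(q dμ)` to `L²(ν)` with squared norm at
most `M`: the square expands into a quadratic form in `w` with the symmetric kernel
`q(x) q(x') ∫ K(x, y) K(x', y) dy`, to which the Schur test with weight `1` applies. -/
theorem lintegral_sq_dual_le (hK : Measurable (Function.uncurry K)) (hq : Measurable q)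
    (hM : ∀ x, ∫⁻ x', q x' * ∫⁻ y, K x y * K x' y ∂ν ∂μ ≤ M) {w : α → ℝ≥0∞} (hw : Measurable w) :
    ∫⁻ y, (∫⁻ x, q x * w x * K x y ∂μ) ^ 2 ∂ν ≤ M * ∫⁻ x, q x * w x ^ 2 ∂μ := by
  set G : α → α → ℝ≥0∞ := fun x x' => ∫⁻ y, K x y * K x' y ∂ν with hGdef
  have hG : Measurable (Function.uncurry G) := by
    apply Measurable.lintegral_prod_right
    fun_prop
  have hGsymm : ∀ x x', G x x' = G x' x := fun x x' => by simp only [hGdef, mul_comm]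
  have key : ∫⁻ y, (∫⁻ x, q x * w x * K x y ∂μ) ^ 2 ∂ν
      = ∫⁻ x, ∫⁻ x', q x * w x * (q x' * w x') * G x x' ∂μ ∂μ := by
    have h1 : ∀ y, (∫⁻ x, q x * w x * K x y ∂μ) ^ 2
        = ∫⁻ x, ∫⁻ x', q x * w x * K x y * (q x' * w x' * K x' y) ∂μ ∂μ := by
      intro y
      rw [sq, ← lintegral_mul_const _ (by fun_prop)]
      refine lintegral_congr fun x => ?_
      rw [lintegral_const_mul _ (by fun_prop)]
    simp_rw [h1]
    rw [lintegral_lintegral_swap]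
    · refine lintegral_congr fun x => ?_
      rw [lintegral_lintegral_swap (by fun_prop)]
      refine lintegral_congr fun x' => ?_
      rw [hGdef, ← lintegral_const_mul _ (by fun_prop)]
      refine lintegral_congr fun y => ?_
      ring
    · apply Measurable.aemeasurable
      apply Measurable.lintegral_prod_right
      fun_prop
  have hA : ∀ x, ∫⁻ x', q x * w x ^ 2 * (q x' * G x x') ∂μ ≤ q x * w x ^ 2 * M := fun x => by
    rw [lintegral_const_mul _ (by fun_prop)]
    gcongr
    exact hM x
  have hfin : ∫⁻ x, ∫⁻ x', q x * w x ^ 2 * (q x' * G x x') ∂μ ∂μ ≤ M * ∫⁻ x, q x * w x ^ 2 ∂μ := by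
    refine (lintegral_mono hA).trans ?_
    rw [lintegral_mul_const _ (by fun_prop), mul_comm]
  have hswap : ∫⁻ x, ∫⁻ x', q x' * w x' ^ 2 * (q x * G x x') ∂μ ∂μ
      = ∫⁻ x, ∫⁻ x', q x * w x ^ 2 * (q x' * G x x') ∂μ ∂μ := by
    rw [lintegral_lintegral_swap (by fun_prop)]
    simp_rw [hGsymm]
  have h2 : 2 * ∫⁻ y, (∫⁻ x, q x * w x * K x y ∂μ) ^ 2 ∂ν
      ≤ 2 * (M * ∫⁻ x, q x * w x ^ 2 ∂μ) := by
    calc 2 * ∫⁻ y, (∫⁻ x, q x * w x * K x y ∂μ) ^ 2 ∂ν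
        = ∫⁻ x, ∫⁻ x', 2 * (q x * w x * (q x' * w x') * G x x') ∂μ ∂μ := by
          rw [key, ← lintegral_const_mul _
            (Measurable.lintegral_prod_right (by fun_prop))]
          refine lintegral_congr fun x => ?_
          rw [lintegral_const_mul _ (by fun_prop)]
      _ ≤ ∫⁻ x, ∫⁻ x', (q x * w x ^ 2 * (q x' * G x x') + q x' * w x' ^ 2 * (q x * G x x'))
            ∂μ ∂μ := by
          refine lintegral_mono fun x => lintegral_mono fun x' => ?_
          calc 2 * (q x * w x * (q x' * w x') * G x x')
              = q x * q x' * G x x' * (2 * (w x * w x')) := by ring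
            _ ≤ q x * q x' * G x x' * (w x ^ 2 + w x' ^ 2) := by
                gcongr
                exact ENNReal.two_mul_mul_le_sq_add_sq _ _
            _ = _ := by ring
      _ = ∫⁻ x, ∫⁻ x', q x * w x ^ 2 * (q x' * G x x') ∂μ ∂μ
          + ∫⁻ x, ∫⁻ x', q x' * w x' ^ 2 * (q x * G x x') ∂μ ∂μ := by
          rw [← lintegral_add_left (Measurable.lintegral_prod_right (by fun_prop))]
          refine lintegral_congr fun x => ?_
          rw [lintegral_add_left (by fun_prop)]
      _ ≤ 2 * (M * ∫⁻ x, q x * w x ^ 2 ∂μ) := by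
          rw [hswap, ← two_mul]
          gcongr
  exact (ENNReal.mul_le_mul_iff_right two_ne_zero ENNReal.ofNat_ne_top).1 h2

/-- Weighted `L²` bound for a nonnegative integral operator: if
`∫ q(x') (∫ K(x, y) K(x', y) dy) dx' ≤ M` for every `x`, then `f ↦ ∫ K(·, y) f(y) dy`
maps `L²(ν)` to `L²(q dμ)` with squared norm at most `M`. -/
theorem lintegral_mul_sq_kernel_le (hK : Measurable (Function.uncurry K)) (hq : Measurable q)
    (hq1 : ∫⁻ x, q x ∂μ ≠ ⊤) (hM0 : M ≠ 0) (hMt : M ≠ ⊤)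
    (hM : ∀ x, ∫⁻ x', q x' * ∫⁻ y, K x y * K x' y ∂ν ∂μ ≤ M)
    {f : β → ℝ≥0∞} (hf : Measurable f) :
    ∫⁻ x, q x * (∫⁻ y, K x y * f y ∂ν) ^ 2 ∂μ ≤ M * ∫⁻ y, f y ^ 2 ∂ν := by
  set w : α → ℝ≥0∞ := fun x => ∫⁻ y, K x y * f y ∂ν with hwdef
  have hw : Measurable w := by
    apply Measurable.lintegral_prod_right
    fun_prop
  -- Truncation makes the left-hand side finite, so that it can be absorbed below.
  have trunc : ∀ N : ℕ, ∫⁻ x, q x * (min (w x) N) ^ 2 ∂μ ≤ M * ∫⁻ y, f y ^ 2 ∂ν := by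
    intro N
    set v : α → ℝ≥0∞ := fun x => min (w x) N with hvdef
    have hv : Measurable v := by fun_prop
    set A := ∫⁻ x, q x * v x ^ 2 ∂μ with hAdef
    have hAtop : A ≠ ⊤ := by
      refine ne_top_of_le_ne_top (b := (∫⁻ x, q x ∂μ) * (N : ℝ≥0∞) ^ 2) ?_ ?_
      · exact ENNReal.mul_ne_top hq1 (by simp)
      · rw [← lintegral_mul_const _ hq]
        refine lintegral_mono fun x => ?_
        dsimp only [hvdef]
        gcongr
        exact min_le_right _ _
    have hh : Measurable fun y => ∫⁻ x, q x * v x * K x y ∂μ := by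
      apply Measurable.lintegral_prod_left
      fun_prop
    have h1 : A ≤ ∫⁻ y, f y * ∫⁻ x, q x * v x * K x y ∂μ ∂ν := by
      calc A ≤ ∫⁻ x, q x * v x * w x ∂μ := by
            refine lintegral_mono fun x => ?_
            dsimp only
            rw [sq, ← mul_assoc]
            gcongr
            exact min_le_left _ _
        _ = ∫⁻ x, ∫⁻ y, f y * (q x * v x * K x y) ∂ν ∂μ := by
            refine lintegral_congr fun x => ?_
            rw [hwdef, ← lintegral_const_mul _ (by fun_prop)]
            refine lintegral_congr fun y => ?_
            ring
        _ = _ := by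
            rw [lintegral_lintegral_swap (by fun_prop)]
            refine lintegral_congr fun y => ?_
            rw [lintegral_const_mul _ (by fun_prop)]
    -- Duality and `lintegral_sq_dual_le` give `2A ≤ M ∫ f² + A`.
    have h2 : A + A ≤ M * ∫⁻ y, f y ^ 2 ∂ν + A := by
      calc A + A ≤ ∫⁻ y, 2 * (f y * ∫⁻ x, q x * v x * K x y ∂μ) ∂ν := by
            rw [lintegral_const_mul _ (by fun_prop), two_mul]
            gcongr
        _ ≤ ∫⁻ y, (M * f y ^ 2 + M⁻¹ * (∫⁻ x, q x * v x * K x y ∂μ) ^ 2) ∂ν :=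
            lintegral_mono fun y => ENNReal.two_mul_mul_le_weighted hM0 hMt _ _
        _ = M * ∫⁻ y, f y ^ 2 ∂ν + M⁻¹ * ∫⁻ y, (∫⁻ x, q x * v x * K x y ∂μ) ^ 2 ∂ν := by
            rw [lintegral_add_left (by fun_prop), lintegral_const_mul _ (by fun_prop),
              lintegral_const_mul _ (by fun_prop)]
        _ ≤ M * ∫⁻ y, f y ^ 2 ∂ν + M⁻¹ * (M * A) := by
            gcongr
            exact lintegral_sq_dual_le hK hq hM hv
        _ = _ := by rw [← mul_assoc, ENNReal.inv_mul_cancel hM0 hMt, one_mul]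
    exact (ENNReal.add_le_add_iff_right hAtop).1 h2
  have hsup : ∀ x, q x * w x ^ 2 = ⨆ N : ℕ, q x * (min (w x) N) ^ 2 := by
    intro x
    have hlim : Filter.Tendsto (fun N : ℕ => min (w x) (N : ℝ≥0∞)) Filter.atTop
        (nhds (w x)) := by
      have := (tendsto_const_nhds (x := w x)).min ENNReal.tendsto_nat_nhds_top
      simpa using this
    have hmono : Monotone fun N : ℕ => q x * (min (w x) (N : ℝ≥0∞)) ^ 2 := by
      intro a b hab
      dsimp only
      gcongr
    refine (iSup_eq_of_tendsto hmono ?_).symm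
    by_cases hw0 : w x = 0
    · simp [hw0]
    · exact ENNReal.Tendsto.const_mul (ENNReal.Tendsto.pow hlim)
        (Or.inl (pow_ne_zero 2 hw0))
  rw [lintegral_congr hsup, lintegral_iSup (fun N => by fun_prop)]
  · exact iSup_le trunc
  · intro a b hab x
    dsimp only
    gcongr

end Schur

/-! ### The logarithmic potential of a density of finite entropy -/

/-- Integration in polar coordinates of a radial function, for the lower integral. -/
theorem lintegral_fun_norm_plane {f : ℝ → ℝ≥0∞} (hf : Measurable f) :
    ∫⁻ x : Plane, f ‖x‖ = ENNReal.ofReal (2 * Real.pi) *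
      ∫⁻ r in Ioi (0 : ℝ), ENNReal.ofReal r * f r := by
  have hmp := (volume : Measure Plane).measurePreserving_homeomorphUnitSphereProd
  have hdim : Module.finrank ℝ Plane = 2 := by simp
  calc ∫⁻ x : Plane, f ‖x‖ = ∫⁻ x : ({(0)}ᶜ : Set Plane), f ‖x.1‖ ∂(volume.comap Subtype.val) := by
        rw [lintegral_subtype_comap (measurableSet_singleton _).compl fun x : Plane => f ‖x‖,
          restrict_compl_singleton]
    _ = ∫⁻ z, f z.2 ∂((volume : Measure Plane).toSphere.prod
          (Measure.volumeIoiPow (Module.finrank ℝ Plane - 1))) := by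
        rw [← hmp.lintegral_comp (by fun_prop)]
        simp
    _ = (volume : Measure Plane).toSphere univ *
          ∫⁻ r : Ioi (0 : ℝ), ENNReal.ofReal r * f r ∂(Measure.comap Subtype.val volume) := by
        rw [lintegral_prod _ (by fun_prop)]
        dsimp only
        rw [lintegral_const, mul_comm, hdim, Measure.volumeIoiPow,
          lintegral_withDensity_eq_lintegral_mul _ (by fun_prop) (by fun_prop)]
        simp
    _ = _ := by
        rw [lintegral_subtype_comap measurableSet_Ioi fun r : ℝ => ENNReal.ofReal r * f r,
          Measure.toSphere_apply_univ, hdim, EuclideanSpace.volume_ball_fin_two]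
        congr 1
        rw [ENNReal.ofReal_mul (by norm_num)]
        simp [ENNReal.ofReal]

/-- The kernel `|z|⁻¹`, cut off at `|z| = 2`; its value at the origin is `0`. -/
noncomputable def truncKernel (z : Plane) : ℝ≥0∞ :=
  if ‖z‖ ≤ 2 then ENNReal.ofReal ‖z‖⁻¹ else 0

theorem measurable_truncKernel : Measurable truncKernel :=
  Measurable.ite (measurableSet_le measurable_norm measurable_const) (by fun_prop) measurable_const

/-- The logarithmic kernel `1 + log (4 / |z|)`, cut off at `|z| = 4`. Up to the factor `4π` it
bounds the convolution of `truncKernel` with itself. -/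
noncomputable def logKernel (z : Plane) : ℝ≥0∞ :=
  if ‖z‖ ≤ 4 then ENNReal.ofReal (1 + Real.log (4 / ‖z‖)) else 0

/-- The profile `(r max(a, r))⁻¹`, cut off at `r = 2`. With `a = |z| / 2` it bounds the product
`|y|⁻¹ |z - y|⁻¹` on the part of the plane where `y` is closer to the origin than to `z`. -/
noncomputable def radialMajorant (a r : ℝ) : ℝ≥0∞ :=
  if r ≤ 2 then ENNReal.ofReal (r * max a r)⁻¹ else 0

theorem measurable_radialMajorant (a : ℝ) : Measurable (radialMajorant a) :=
  Measurable.ite (measurableSet_le measurable_id measurable_const) (by fun_prop) measurable_const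

theorem lintegral_radialMajorant {a : ℝ} (ha : 0 < a) (ha2 : a ≤ 2) :
    ∫⁻ x : Plane, radialMajorant a ‖x‖ = ENNReal.ofReal (2 * Real.pi * (1 + Real.log (2 / a))) := by
  rw [lintegral_fun_norm_plane (measurable_radialMajorant a)]
  have h1 : ∀ r ∈ Ioi (0 : ℝ), ENNReal.ofReal r * radialMajorant a r
      = (Ioc (0 : ℝ) 2).indicator (fun r => ENNReal.ofReal (max a r)⁻¹) r := by
    intro r (hr : 0 < r)
    by_cases h : r ≤ 2
    · rw [indicator_of_mem (show r ∈ Ioc (0 : ℝ) 2 from ⟨hr, h⟩), radialMajorant, if_pos h,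
        ← ENNReal.ofReal_mul hr.le, mul_inv, ← mul_assoc, mul_inv_cancel₀ hr.ne', one_mul]
    · simp [radialMajorant, h]
  rw [setLIntegral_congr_fun measurableSet_Ioi h1, lintegral_indicator measurableSet_Ioc,
    Measure.restrict_restrict measurableSet_Ioc,
    inter_eq_left.2 (Ioc_subset_Ioi_self : Ioc (0 : ℝ) 2 ⊆ Ioi 0),
    ENNReal.ofReal_mul (p := 2 * Real.pi) (by positivity)]
  congr 1
  have hcont : Continuous fun r : ℝ => (max a r)⁻¹ :=
    (continuous_const.max continuous_id).inv₀ fun r => (lt_max_of_lt_left ha).ne'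
  rw [← ofReal_integral_eq_lintegral_ofReal (hcont.integrableOn_Ioc)
    (Filter.Eventually.of_forall fun r => inv_nonneg.2 (le_max_of_le_left ha.le)),
    ← intervalIntegral.integral_of_le (by norm_num),
    ← intervalIntegral.integral_add_adjacent_intervals (b := a) (hcont.intervalIntegrable _ _)
      (hcont.intervalIntegrable _ _)]
  have e1 : ∫ r in (0 : ℝ)..a, (max a r)⁻¹ = 1 := by
    rw [intervalIntegral.integral_congr (g := fun _ => a⁻¹)]
    · simp [ha.ne']
    · intro r hr
      rw [uIcc_of_le ha.le] at hr
      simp [max_eq_left hr.2]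
  have e2 : ∫ r in a..2, (max a r)⁻¹ = Real.log (2 / a) := by
    rw [intervalIntegral.integral_congr (g := fun r => r⁻¹)]
    · exact integral_inv_of_pos ha (by norm_num)
    · intro r hr
      rw [uIcc_of_le ha2] at hr
      simp [max_eq_right hr.1]
  rw [e1, e2]

theorem truncKernel_mul_le (z y : Plane) :
    truncKernel y * truncKernel (z - y) ≤
      radialMajorant (‖z‖ / 2) ‖y‖ + radialMajorant (‖z‖ / 2) ‖z - y‖ := by
  wlog h : ‖y‖ ≤ ‖z - y‖ generalizing y
  · have := this (z - y) (by rw [sub_sub_cancel]; exact le_of_not_ge h)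
    rwa [sub_sub_cancel, mul_comm, add_comm] at this
  refine le_add_right ?_
  by_cases h2 : ‖z - y‖ ≤ 2
  · have hy2 : ‖y‖ ≤ 2 := h.trans h2
    rw [truncKernel, truncKernel, radialMajorant, if_pos h2, if_pos hy2, if_pos hy2,
      ← ENNReal.ofReal_mul (by positivity), ← mul_inv]
    rcases eq_or_ne ‖y‖ 0 with h0 | h0
    · simp [h0]
    have hy : 0 < ‖y‖ := lt_of_le_of_ne (norm_nonneg _) h0.symm
    have hz : ‖z‖ / 2 ≤ ‖z - y‖ := by
      have := norm_add_le (z - y) y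
      rw [sub_add_cancel] at this
      linarith
    apply ENNReal.ofReal_le_ofReal
    gcongr
    exact max_le hz h
  · simp [truncKernel, h2]

theorem lintegral_truncKernel_mul_le {z : Plane} (hz : z ≠ 0) :
    ∫⁻ y, truncKernel y * truncKernel (z - y) ≤
      ENNReal.ofReal (4 * Real.pi) * logKernel z := by
  by_cases h4 : ‖z‖ ≤ 4
  · have hz0 : 0 < ‖z‖ := norm_pos_iff.2 hz
    calc ∫⁻ y, truncKernel y * truncKernel (z - y)
        ≤ ∫⁻ y, (radialMajorant (‖z‖ / 2) ‖y‖ + radialMajorant (‖z‖ / 2) ‖z - y‖) :=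
          lintegral_mono fun y => truncKernel_mul_le z y
      _ = ENNReal.ofReal 2 * ∫⁻ y : Plane, radialMajorant (‖z‖ / 2) ‖y‖ := by
          have := measurable_radialMajorant (‖z‖ / 2)
          rw [lintegral_add_left (by fun_prop),
            lintegral_sub_left_eq_self (fun y : Plane => radialMajorant (‖z‖ / 2) ‖y‖),
            ENNReal.ofReal_ofNat, two_mul]
      _ = _ := by
          rw [lintegral_radialMajorant (by positivity) (by linarith), logKernel, if_pos h4,
            ← ENNReal.ofReal_mul (by norm_num),
            ← ENNReal.ofReal_mul (by positivity)]
          congr 1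
          rw [show 2 / (‖z‖ / 2) = 4 / ‖z‖ by field_simp; norm_num]
          ring
  · have : ∀ y, truncKernel y * truncKernel (z - y) = 0 := by
      intro y
      by_cases h1 : ‖y‖ ≤ 2
      · have h2 : ¬ ‖z - y‖ ≤ 2 := by
          intro h2
          have := norm_add_le (z - y) y
          rw [sub_add_cancel] at this
          linarith
        simp [truncKernel, h2]
      · simp [truncKernel, h1]
    simp [this]

/-- The Legendre duality between `s ln s` and `exp (t - 1)`. -/
theorem mul_le_mul_abs_log_add_exp {s : ℝ} (hs : 0 ≤ s) (t : ℝ) :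
    s * t ≤ s * |Real.log s| + Real.exp (t - 1) := by
  rcases hs.eq_or_lt with rfl | hs
  · simp; positivity
  have h := Real.add_one_le_exp (t - 1 - Real.log s)
  rw [Real.exp_sub, Real.exp_log hs, le_div_iff₀ hs] at h
  have h2 : s * Real.log s ≤ s * |Real.log s| := by gcongr; exact le_abs_self _
  nlinarith

/-- As `exp (logKernel z - 1) = 4 / |z|` is locally integrable, Legendre duality splits a product
with `logKernel` into an entropy and an integrable function of `z`. -/
theorem ofReal_mul_logKernel_le (s : ℝ) {z : Plane} (hz : z ≠ 0) :
    ENNReal.ofReal s * logKernel z ≤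
      ENNReal.ofReal (s * |Real.log s|) + if ‖z‖ ≤ 4 then ENNReal.ofReal (4 / ‖z‖) else 0 := by
  by_cases h4 : ‖z‖ ≤ 4
  · have hz0 : 0 < ‖z‖ := norm_pos_iff.2 hz
    rcases le_total s 0 with hs | hs
    · simp [ENNReal.ofReal_of_nonpos hs]
    rw [logKernel, if_pos h4, if_pos h4, ← ENNReal.ofReal_mul hs,
      ← ENNReal.ofReal_add (by positivity) (by positivity)]
    apply ENNReal.ofReal_le_ofReal
    have := mul_le_mul_abs_log_add_exp hs (1 + Real.log (4 / ‖z‖))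
    rwa [add_sub_cancel_left, Real.exp_log (by positivity)] at this
  · simp [logKernel, h4]

theorem lintegral_inv_norm_plane :
    ∫⁻ z : Plane, (if ‖z‖ ≤ 4 then ENNReal.ofReal (4 / ‖z‖) else 0)
      = ENNReal.ofReal (32 * Real.pi) := by
  rw [lintegral_fun_norm_plane (f := fun r => if r ≤ 4 then ENNReal.ofReal (4 / r) else 0)
    (Measurable.ite (measurableSet_le measurable_id measurable_const) (by fun_prop)
      measurable_const)]
  have h1 : ∀ r ∈ Ioi (0 : ℝ), ENNReal.ofReal r * (if r ≤ 4 then ENNReal.ofReal (4 / r) else 0)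
      = (Ioc (0 : ℝ) 4).indicator (fun _ => ENNReal.ofReal 4) r := by
    intro r (hr : 0 < r)
    by_cases h : r ≤ 4
    · rw [indicator_of_mem (show r ∈ Ioc (0 : ℝ) 4 from ⟨hr, h⟩), if_pos h,
        ← ENNReal.ofReal_mul hr.le, mul_div_cancel₀ _ hr.ne']
    · simp [h]
  rw [setLIntegral_congr_fun measurableSet_Ioi h1, lintegral_indicator measurableSet_Ioc,
    Measure.restrict_restrict measurableSet_Ioc,
    inter_eq_left.2 (Ioc_subset_Ioi_self : Ioc (0 : ℝ) 4 ⊆ Ioi 0), setLIntegral_const,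
    Real.volume_Ioc, ← ENNReal.ofReal_mul (by norm_num), ← ENNReal.ofReal_mul (by positivity)]
  congr 1
  ring

/-- The Schur condition of `lintegral_mul_sq_kernel_le` for `truncKernel`: the logarithmic potential
of a density is bounded everywhere in terms of its entropy. -/
theorem lintegral_mul_truncKernel_sq_le {q : Plane → ℝ} (hq : Measurable q) (x : Plane) :
    ∫⁻ x', ENNReal.ofReal (q x') * ∫⁻ y, truncKernel (x - y) * truncKernel (x' - y) ≤
      ENNReal.ofReal (4 * Real.pi) * (absEntropy q + ENNReal.ofReal (32 * Real.pi)) := by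
  have hne : ∀ᵐ x' : Plane, x' ≠ x := by
    simp [ae_iff]
  calc ∫⁻ x', ENNReal.ofReal (q x') * ∫⁻ y, truncKernel (x - y) * truncKernel (x' - y)
      ≤ ∫⁻ x', ENNReal.ofReal (4 * Real.pi) * (ENNReal.ofReal (q x' * |Real.log (q x')|)
          + if ‖x - x'‖ ≤ 4 then ENNReal.ofReal (4 / ‖x - x'‖) else 0) := by
        refine lintegral_mono_ae ?_
        filter_upwards [hne] with x' hx'
        have hz : x - x' ≠ 0 := sub_ne_zero.2 (Ne.symm hx')
        have h1 : ∫⁻ y, truncKernel (x - y) * truncKernel (x' - y)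
            = ∫⁻ y, truncKernel y * truncKernel ((x - x') - y) := by
          rw [← lintegral_sub_left_eq_self
            (fun y => truncKernel y * truncKernel ((x - x') - y)) x]
          refine lintegral_congr fun y => ?_
          congr 1
          rw [truncKernel, truncKernel,
            show x - x' - (x - y) = -(x' - y) by abel, norm_neg]
        rw [h1]
        calc _ ≤ ENNReal.ofReal (q x') * (ENNReal.ofReal (4 * Real.pi) * logKernel (x - x')) := by
              gcongr
              exact lintegral_truncKernel_mul_le hz
          _ = ENNReal.ofReal (4 * Real.pi) * (ENNReal.ofReal (q x') * logKernel (x - x')) := by ring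
          _ ≤ _ := by
              gcongr
              exact ofReal_mul_logKernel_le _ hz
    _ = _ := by
        rw [lintegral_const_mul' _ _ ENNReal.ofReal_ne_top, lintegral_add_left (by fun_prop),
          lintegral_sub_left_eq_self
            (fun z : Plane => if ‖z‖ ≤ 4 then ENNReal.ofReal (4 / ‖z‖) else 0),
          lintegral_inv_norm_plane, absEntropy]

/-- The truncated potential of `f ∈ L²` is square integrable against a density of finite entropy.
This takes the place of the exponential integrability in the Trudinger–Moser inequality. -/
theorem lintegral_mul_sq_truncKernel_le {q : Plane → ℝ} (hq : AEMeasurable q)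
    (hq1 : ∫⁻ x, ENNReal.ofReal (q x) ≠ ⊤) (hent : absEntropy q ≠ ⊤)
    {f : Plane → ℝ≥0∞} (hf : AEMeasurable f) :
    ∫⁻ x, ENNReal.ofReal (q x) * (∫⁻ y, truncKernel (x - y) * f y) ^ 2 ≤
      ENNReal.ofReal (4 * Real.pi) * (absEntropy q + ENNReal.ofReal (32 * Real.pi))
        * ∫⁻ y, f y ^ 2 := by
  wlog hqm : Measurable q generalizing q
  · have h := hq.ae_eq_mk
    have h1 : absEntropy (hq.mk q) = absEntropy q :=
      lintegral_congr_ae (h.mono fun x hx => by simp only [hx])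
    have := @this (hq.mk q) hq.measurable_mk.aemeasurable
      (by rwa [lintegral_congr_ae (g := fun x => ENNReal.ofReal (q x))
        (h.mono fun x hx => by simp only [hx])]) (by rwa [h1]) hq.measurable_mk
    rw [h1] at this
    refine le_trans (le_of_eq (lintegral_congr_ae (h.mono fun x hx => ?_))) this
    simp only [hx]
  wlog hfm : Measurable f generalizing f
  · have h := hf.ae_eq_mk
    have := @this (hf.mk f) hf.measurable_mk.aemeasurable hf.measurable_mk
    rw [lintegral_congr_ae (f := fun y => f y ^ 2) (g := fun y => hf.mk f y ^ 2)
      (h.mono fun x hx => by simp only [hx])]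
    refine le_trans (le_of_eq (lintegral_congr fun x => ?_)) this
    rw [lintegral_congr_ae (h.mono fun y hy => ?_)]
    simp only [hy]
  refine lintegral_mul_sq_kernel_le (K := fun x y => truncKernel (x - y)) ?_ (by fun_prop) hq1 ?_ ?_
    (lintegral_mul_truncKernel_sq_le hqm) hfm
  · have := measurable_truncKernel
    fun_prop
  · have := Real.pi_pos
    simp [this]
  · exact ENNReal.mul_ne_top ENNReal.ofReal_ne_top
      (ENNReal.add_ne_top.2 ⟨hent, ENNReal.ofReal_ne_top⟩)

/-! ### Domination by a Riesz potential -/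

/-- A smooth function on the line that vanishes on `(-∞, 1]` and equals `s⁻¹` on `[2, ∞)`. -/
noncomputable def cutInv (s : ℝ) : ℝ := Real.smoothTransition (s - 1) / s

theorem cutInv_of_le_one {s : ℝ} (hs : s ≤ 1) : cutInv s = 0 := by
  rw [cutInv, Real.smoothTransition.zero_of_nonpos (by linarith), zero_div]

theorem cutInv_of_two_le {s : ℝ} (hs : 2 ≤ s) : cutInv s = s⁻¹ := by
  rw [cutInv, Real.smoothTransition.one_of_one_le (by linarith), one_div]

theorem cutInv_nonneg {s : ℝ} (hs : 0 ≤ s) : 0 ≤ cutInv s :=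
  div_nonneg (Real.smoothTransition.nonneg _) hs

theorem cutInv_le_inv {s : ℝ} (hs : 0 ≤ s) : cutInv s ≤ s⁻¹ := by
  rw [cutInv, ← one_div]
  gcongr
  exact Real.smoothTransition.le_one _

theorem contDiff_cutInv : ContDiff ℝ ∞ cutInv := by
  rw [contDiff_iff_contDiffAt]
  intro s
  rcases lt_or_ge s 1 with hs | hs
  · refine (contDiffAt_const (c := (0 : ℝ))).congr_of_eventuallyEq ?_
    filter_upwards [Iio_mem_nhds hs] with t ht using cutInv_of_le_one (le_of_lt ht)
  · have h : ContDiff ℝ ∞ Real.smoothTransition := Real.smoothTransition.contDiff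
    exact ContDiffAt.div (h.contDiffAt.comp s (by fun_prop)) contDiffAt_id (by positivity)

theorem hasDerivAt_cutInv (s : ℝ) : HasDerivAt cutInv (deriv cutInv s) s :=
  (contDiff_cutInv.differentiable (by simp) s).hasDerivAt

theorem continuous_deriv_cutInv : Continuous (deriv cutInv) :=
  contDiff_cutInv.continuous_deriv (by simp)

/-- The divergence of the planar vector field `z ↦ cutInv (|z|²) z` as a function of `s = |z|²`. It
is supported in `[1, 2]`, as the field is `z / |z|²` farther out. -/
noncomputable def radialBump (s : ℝ) : ℝ := 2 * (cutInv s + s * deriv cutInv s)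

/-- In terms of the primitive `s cutInv(s) = smoothTransition (s - 1)`, which is constant off
`[1, 2]`, `radialBump` is twice a derivative; this gives its support and its integral. -/
theorem hasDerivAt_smoothTransition_sub_one (s : ℝ) :
    HasDerivAt (fun s => Real.smoothTransition (s - 1)) (radialBump s / 2) s := by
  have h : (fun s => Real.smoothTransition (s - 1)) = fun s => s * cutInv s := by
    funext t
    rcases eq_or_ne t 0 with rfl | ht
    · simp [Real.smoothTransition.zero_of_nonpos]
    · rw [cutInv, mul_div_cancel₀ _ ht]
  rw [h]
  refine ((hasDerivAt_id s).mul (hasDerivAt_cutInv s)).congr_deriv ?_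
  simp [radialBump]

theorem continuous_radialBump : Continuous radialBump := by
  have := continuous_deriv_cutInv
  have := contDiff_cutInv.continuous
  unfold radialBump
  fun_prop

theorem radialBump_of_lt_one {s : ℝ} (hs : s < 1) : radialBump s = 0 := by
  have h : HasDerivAt (fun s => Real.smoothTransition (s - 1)) 0 s := by
    refine (hasDerivAt_const s (0 : ℝ)).congr_of_eventuallyEq ?_
    filter_upwards [Iio_mem_nhds hs] with t ht
    exact Real.smoothTransition.zero_of_nonpos (sub_nonpos.2 (le_of_lt ht))
  linarith [h.unique (hasDerivAt_smoothTransition_sub_one s)]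

theorem radialBump_of_two_lt {s : ℝ} (hs : 2 < s) : radialBump s = 0 := by
  have h : HasDerivAt (fun s => Real.smoothTransition (s - 1)) 0 s := by
    refine (hasDerivAt_const s (1 : ℝ)).congr_of_eventuallyEq ?_
    filter_upwards [Ioi_mem_nhds hs] with t ht
    exact Real.smoothTransition.one_of_one_le (by have : 2 < t := ht; linarith)
  linarith [h.unique (hasDerivAt_smoothTransition_sub_one s)]

theorem exists_abs_radialBump_le : ∃ B, 0 < B ∧ ∀ s, |radialBump s| ≤ B := by
  obtain ⟨B, hB⟩ := (isCompact_Icc (a := (1 : ℝ)) (b := 2)).exists_bound_of_continuousOn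
    continuous_radialBump.continuousOn
  refine ⟨max B 1, by positivity, fun s => ?_⟩
  rcases lt_or_ge s 1 with h1 | h1
  · simp [radialBump_of_lt_one h1]
  rcases lt_or_ge 2 s with h2 | h2
  · simp [radialBump_of_two_lt h2]
  · exact (hB s ⟨h1, h2⟩).trans (le_max_left _ _)

theorem integral_radialBump : ∫ z : Plane, radialBump (‖z‖ ^ 2) = 2 * Real.pi := by
  rw [integral_fun_norm_addHaar volume fun r => radialBump (r ^ 2)]
  have hcomp : HasCompactSupport fun y : ℝ => y * radialBump (y ^ 2) := by
    refine HasCompactSupport.intro (isCompact_Icc (a := (-2 : ℝ)) (b := 2)) fun y hy => ?_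
    rw [radialBump_of_two_lt, mul_zero]
    by_contra! h
    exact hy (abs_le.1 (by nlinarith [sq_abs y, abs_nonneg y]))
  have hcont : Continuous fun y : ℝ => y * radialBump (y ^ 2) := by
    have := continuous_radialBump
    fun_prop
  have hd : ∀ y : ℝ, HasDerivAt (fun y => Real.smoothTransition (y ^ 2 - 1))
      (y * radialBump (y ^ 2)) y := by
    intro y
    refine ((hasDerivAt_smoothTransition_sub_one (y ^ 2)).comp y
      (hasDerivAt_pow 2 y)).congr_deriv ?_
    simp
    ring
  have hlim : Filter.Tendsto (fun y : ℝ => Real.smoothTransition (y ^ 2 - 1)) Filter.atTop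
      (nhds 1) := by
    refine tendsto_const_nhds.congr' ?_
    filter_upwards [Filter.eventually_ge_atTop 2] with y hy
    exact (Real.smoothTransition.one_of_one_le (by nlinarith)).symm
  have h := integral_Ioi_of_hasDerivAt_of_tendsto' (a := 0) (fun y _ => hd y)
    (hcont.integrable_of_hasCompactSupport hcomp).integrableOn hlim
  have h2 : Module.finrank ℝ Plane = 2 := by simp
  simp only [h2, Nat.add_one_sub_one, pow_one, smul_eq_mul]
  rw [h, Measure.real, EuclideanSpace.volume_ball_fin_two]
  rw [Real.smoothTransition.zero_of_nonpos (by norm_num)]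
  simp [Real.pi_pos.le]

theorem integral_radialBump_scaled {δ : ℝ} (hδ : 0 < δ) (x : Plane) :
    ∫ y : Plane, (δ ^ 2)⁻¹ * radialBump ((δ ^ 2)⁻¹ * ‖x - y‖ ^ 2) = 2 * Real.pi := by
  rw [integral_sub_left_eq_self
    (fun y : Plane => (δ ^ 2)⁻¹ * radialBump ((δ ^ 2)⁻¹ * ‖y‖ ^ 2)), integral_const_mul]
  have h : ∀ y : Plane, radialBump ((δ ^ 2)⁻¹ * ‖y‖ ^ 2) = radialBump (‖δ⁻¹ • y‖ ^ 2) := by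
    intro y
    rw [norm_smul, mul_pow, Real.norm_eq_abs, sq_abs, inv_pow]
  simp_rw [h]
  rw [Measure.integral_comp_smul volume (fun y : Plane => radialBump (‖y‖ ^ 2)),
    integral_radialBump]
  have h2 : Module.finrank ℝ Plane = 2 := by simp
  rw [h2, inv_pow, inv_inv, abs_of_pos (by positivity), smul_eq_mul, ← mul_assoc,
    inv_mul_cancel₀ (by positivity), one_mul]

section

variable {V : Type} [NormedAddCommGroup V] [InnerProductSpace ℝ V] [FiniteDimensional ℝ V]

/-- The rescaled bumps are an approximate identity of total mass `2π`. -/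
theorem ae_tendsto_integral_radialBump {u : Plane → V} (hu : LocallyIntegrable u volume) :
    ∀ᵐ x : Plane, Filter.Tendsto (fun δ : ℝ =>
      ∫ y, ((δ ^ 2)⁻¹ * radialBump ((δ ^ 2)⁻¹ * ‖x - y‖ ^ 2)) • u y)
      (nhdsWithin 0 (Ioi 0)) (nhds ((2 * Real.pi) • u x)) := by
  obtain ⟨B, hB0, hB⟩ := exists_abs_radialBump_le
  filter_upwards [IsUnifLocDoublingMeasure.ae_tendsto_average_norm_sub volume hu 1] with x hx
  have h2 : Filter.Tendsto (fun δ : ℝ => 2 * δ) (nhdsWithin 0 (Ioi 0))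
      (nhdsWithin 0 (Ioi 0)) := by
    refine tendsto_nhdsWithin_iff.2 ⟨?_, ?_⟩
    · exact tendsto_nhdsWithin_of_tendsto_nhds
        (by simpa using (continuous_const_mul (2 : ℝ)).tendsto 0)
    · filter_upwards [self_mem_nhdsWithin] with δ (hδ : 0 < δ)
      exact mul_pos two_pos hδ
  have hav := hx (fun _ => x) _ h2 (by
    filter_upwards [self_mem_nhdsWithin] with δ (hδ : 0 < δ)
    exact Metric.mem_closedBall_self (by positivity))
  have key := tendsto_integral_smul_of_tendsto_average_norm_sub
    (g := fun δ y => (2 * Real.pi)⁻¹ * ((δ ^ 2)⁻¹ * radialBump ((δ ^ 2)⁻¹ * ‖x - y‖ ^ 2)))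
    (2 * B) hav
    (Filter.Eventually.of_forall fun δ => hu.integrableOn_isCompact (isCompact_closedBall _ _))
    ?_ ?_ ?_
  · refine (key.const_smul (2 * Real.pi)).congr fun δ => ?_
    rw [← integral_smul]
    refine integral_congr_ae (Filter.Eventually.of_forall fun y => ?_)
    dsimp only
    rw [smul_smul, ← mul_assoc, mul_inv_cancel₀ (by positivity), one_mul]
  · refine tendsto_const_nhds.congr' ?_
    filter_upwards [self_mem_nhdsWithin] with δ (hδ : 0 < δ)
    rw [integral_const_mul, integral_radialBump_scaled hδ, inv_mul_cancel₀ (by positivity)]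
  · filter_upwards [self_mem_nhdsWithin] with δ (hδ : 0 < δ)
    intro y hy
    by_contra hyb
    refine hy ?_
    dsimp only
    rw [radialBump_of_two_lt, mul_zero, mul_zero]
    rw [Metric.mem_closedBall, not_le, dist_comm, dist_eq_norm] at hyb
    rw [inv_mul_eq_div, lt_div_iff₀ (by positivity)]
    nlinarith
  · filter_upwards [self_mem_nhdsWithin] with δ (hδ : 0 < δ)
    intro y
    rw [Measure.real, EuclideanSpace.volume_closedBall_fin_two]
    have hvol : (ENNReal.ofReal (2 * δ) ^ 2 * ENNReal.ofReal Real.pi).toReal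
        = (2 * δ) ^ 2 * Real.pi := by
      simp [ENNReal.toReal_ofReal hδ.le, Real.pi_pos.le]
    rw [hvol, abs_mul, abs_mul, abs_of_pos (by positivity), abs_of_pos (by positivity)]
    calc (2 * Real.pi)⁻¹ * ((δ ^ 2)⁻¹ * |radialBump ((δ ^ 2)⁻¹ * ‖x - y‖ ^ 2)|)
        ≤ (2 * Real.pi)⁻¹ * ((δ ^ 2)⁻¹ * B) := by
          gcongr
          exact hB _
      _ = 2 * B / ((2 * δ) ^ 2 * Real.pi) := by
          field_simp

end

/-- The profile of the regularized field `fieldComp`: the difference of `cutInv` rescaled to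
`s ∼ ε` and `cutInv` itself. The two cancel for `s > 2`, and both are at most `s⁻¹`. -/
noncomputable def fieldProfile (ε s : ℝ) : ℝ := ε⁻¹ * cutInv (ε⁻¹ * s) - cutInv s

theorem contDiff_fieldProfile (ε : ℝ) : ContDiff ℝ ∞ (fieldProfile ε) := by
  have := contDiff_cutInv
  unfold fieldProfile
  fun_prop

theorem hasDerivAt_fieldProfile (ε s : ℝ) : HasDerivAt (fieldProfile ε)
    (ε⁻¹ * (deriv cutInv (ε⁻¹ * s) * ε⁻¹) - deriv cutInv s) s := by
  have h := (hasDerivAt_cutInv (ε⁻¹ * s)).comp s ((hasDerivAt_id s).const_mul ε⁻¹)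
  refine ((h.const_mul ε⁻¹).sub (hasDerivAt_cutInv s)).congr_deriv ?_
  simp

/-- The divergence of the field with components `fieldComp ε i`, as a function of `s = |z|²`. -/
theorem two_mul_fieldProfile_add (ε s : ℝ) :
    2 * (fieldProfile ε s + s * deriv (fieldProfile ε) s)
      = ε⁻¹ * radialBump (ε⁻¹ * s) - radialBump s := by
  rw [(hasDerivAt_fieldProfile ε s).deriv, fieldProfile, radialBump, radialBump]
  ring

theorem fieldProfile_of_two_lt {ε s : ℝ} (hε : 0 < ε) (hε1 : ε ≤ 1) (hs : 2 < s) :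
    fieldProfile ε s = 0 := by
  have h : s ≤ ε⁻¹ * s := le_mul_of_one_le_left (by linarith) ((one_le_inv₀ hε).2 hε1)
  rw [fieldProfile, cutInv_of_two_le (by linarith), cutInv_of_two_le hs.le, mul_inv, inv_inv,
    inv_mul_cancel_left₀ hε.ne', sub_self]

theorem abs_fieldProfile_le {ε s : ℝ} (hε : 0 < ε) (hs : 0 ≤ s) : |fieldProfile ε s| ≤ s⁻¹ := by
  have h1 : ε⁻¹ * cutInv (ε⁻¹ * s) ≤ s⁻¹ := by
    calc ε⁻¹ * cutInv (ε⁻¹ * s) ≤ ε⁻¹ * (ε⁻¹ * s)⁻¹ := by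
          gcongr
          exact cutInv_le_inv (by positivity)
      _ = s⁻¹ := by rw [mul_inv, inv_inv, inv_mul_cancel_left₀ hε.ne']
  have h2 : 0 ≤ ε⁻¹ * cutInv (ε⁻¹ * s) :=
    mul_nonneg (by positivity) (cutInv_nonneg (by positivity))
  rw [abs_le, fieldProfile]
  constructor <;> linarith [cutInv_nonneg hs, cutInv_le_inv hs]

/-- The `i`-th component of a smooth, compactly supported vector field that regularizes `z / |z|²`
near the origin. Its divergence is a bump of mass `2π` at scale `√ε` minus a fixed bump. -/
noncomputable def fieldComp (ε : ℝ) (i : Fin 2) (z : Plane) : ℝ := z i * fieldProfile ε (‖z‖ ^ 2)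

theorem isTestFunction_fieldComp {ε : ℝ} (hε : 0 < ε) (hε1 : ε ≤ 1) (i : Fin 2) (x : Plane) :
    IsTestFunction planeProj fun y => fieldComp ε i (x - y) where
  smooth := by
    have h1 : ContDiff ℝ ∞ fun y : Plane => ‖x - y‖ ^ 2 :=
      (contDiff_const.sub contDiff_id).norm_sq ℝ
    have h2 : ContDiff ℝ ∞ fun y : Plane => (x - y) i := by fun_prop
    exact h2.mul ((contDiff_fieldProfile ε).comp h1)
  compactSupport := by
    refine HasCompactSupport.intro (isCompact_closedBall x 2) fun y hy => ?_
    rw [Metric.mem_closedBall, not_le, dist_comm, dist_eq_norm] at hy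
    rw [fieldComp, fieldProfile_of_two_lt hε hε1 (by nlinarith), mul_zero]

theorem enorm_fieldComp_le {ε : ℝ} (hε : 0 < ε) (hε1 : ε ≤ 1) (i : Fin 2) (z : Plane) :
    ‖fieldComp ε i z‖ₑ ≤ truncKernel z := by
  by_cases hz : ‖z‖ ≤ 2
  · rw [truncKernel, if_pos hz, Real.enorm_eq_ofReal_abs]
    apply ENNReal.ofReal_le_ofReal
    rw [fieldComp, abs_mul]
    have h1 : |z i| ≤ ‖z‖ := by simpa using PiLp.norm_apply_le z i
    calc |z i| * |fieldProfile ε (‖z‖ ^ 2)| ≤ ‖z‖ * (‖z‖ ^ 2)⁻¹ := by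
          gcongr
          exact abs_fieldProfile_le hε (by positivity)
      _ = ‖z‖⁻¹ := by
          rcases eq_or_ne ‖z‖ 0 with h | h
          · simp [h]
          · field_simp
  · rw [fieldComp, fieldProfile_of_two_lt hε hε1 (by nlinarith), mul_zero]
    simp

theorem planeProj_single (i : Fin 2) (s : ℝ) :
    planeProj (EuclideanSpace.single i s) = s • EuclideanSpace.single i (1 : ℝ) := by
  ext j
  rcases eq_or_ne j i with rfl | hj
  · simp [planeProj]
  · simp [planeProj, hj]

theorem partialDeriv_fieldComp (ε : ℝ) (i : Fin 2) (x y : Plane) :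
    partialDeriv planeProj i (fun y => fieldComp ε i (x - y)) y =
      -(fieldProfile ε (‖x - y‖ ^ 2)
        + 2 * (x - y) i ^ 2 * deriv (fieldProfile ε) (‖x - y‖ ^ 2)) := by
  set z := x - y with hz
  have h1 : (fun s : ℝ => fieldComp ε i (x - (y + planeProj (EuclideanSpace.single i s))))
      = fun s => (z i - s) * fieldProfile ε (‖z‖ ^ 2 - 2 * (z i * s) + s ^ 2) := by
    funext s
    have e : x - (y + planeProj (EuclideanSpace.single i s)) = z - EuclideanSpace.single i s := by
      simp only [hz, planeProj, AddMonoidHom.id_apply]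
      abel
    rw [e, fieldComp, norm_sub_sq_real]
    simp [EuclideanSpace.inner_single_right, mul_comm]
  rw [partialDeriv, h1]
  have h2 : HasDerivAt (fun s : ℝ => ‖z‖ ^ 2 - 2 * (z i * s) + s ^ 2) (-(2 * z i)) 0 := by
    have := ((((hasDerivAt_id (0 : ℝ)).const_mul (z i)).const_mul 2).const_sub (‖z‖ ^ 2)).add
      (hasDerivAt_pow 2 (0 : ℝ))
    refine this.congr_deriv ?_
    simp
  have h3 : HasDerivAt (fieldProfile ε) (deriv (fieldProfile ε) (‖z‖ ^ 2))
      (‖z‖ ^ 2 - 2 * (z i * 0) + 0 ^ 2) := by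
    simpa using ((contDiff_fieldProfile ε).differentiable (by simp) (‖z‖ ^ 2)).hasDerivAt
  have h4 := ((hasDerivAt_id (0 : ℝ)).const_sub (z i)).mul (h3.comp 0 h2)
  refine (h4.congr_deriv ?_).deriv
  simp
  ring

section

variable {V : Type} [NormedAddCommGroup V] [InnerProductSpace ℝ V]

theorem continuous_partialDeriv_plane {η : Plane → ℝ} (hη : IsTestFunction planeProj η)
    (i : Fin 2) : Continuous (partialDeriv planeProj i η)
    ∧ HasCompactSupport (partialDeriv planeProj i η) := by
  have hs : ContDiff ℝ ∞ η := hη.smooth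
  have h : partialDeriv planeProj i η = fun y => fderiv ℝ η y (EuclideanSpace.single i 1) := by
    funext y
    have e : (fun s : ℝ => η (y + planeProj (EuclideanSpace.single i s)))
        = fun s : ℝ => η (y + s • EuclideanSpace.single i (1 : ℝ)) := by
      funext s
      rw [planeProj_single]
    rw [partialDeriv, e]
    have := (hs.differentiable (by simp) y).hasFDerivAt.hasLineDerivAt (EuclideanSpace.single i 1)
    exact this.deriv
  rw [h]
  refine ⟨(hs.continuous_fderiv (by simp)).clm_apply continuous_const, ?_⟩
  exact hη.compactSupport.fderiv_apply ℝ _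

/-- The definition of the weak gradient, tested against the components of the regularized field
centred at `x` and summed over them. -/
theorem integral_radialBump_eq {u : Plane → V} {g : Fin 2 → Plane → V}
    (h : ∀ i, IsWeakPartial planeProj i u (g i)) {ε : ℝ} (hε : 0 < ε) (hε1 : ε ≤ 1) (x : Plane) :
    ∫ y, (ε⁻¹ * radialBump (ε⁻¹ * ‖x - y‖ ^ 2) - radialBump (‖x - y‖ ^ 2)) • u y
      = ∑ i, ∫ y, fieldComp ε i (x - y) • g i y := by
  have hT := fun i => isTestFunction_fieldComp hε hε1 i x
  have hint : ∀ i, Integrable (fun y =>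
      partialDeriv planeProj i (fun y => fieldComp ε i (x - y)) y • u y) := fun i =>
    (h i).locallyIntegrable.integrable_smul_left_of_hasCompactSupport
      (continuous_partialDeriv_plane (hT i) i).1 (continuous_partialDeriv_plane (hT i) i).2
  have h1 : ∀ i, ∫ y, fieldComp ε i (x - y) • g i y
      = - ∫ y, partialDeriv planeProj i (fun y => fieldComp ε i (x - y)) y • u y := fun i => by
    rw [(h i).integral_eq _ (hT i), neg_neg]
  simp_rw [h1]
  rw [Finset.sum_neg_distrib, ← integral_finsetSum _ fun i _ => hint i, ← integral_neg]
  refine integral_congr_ae (Filter.Eventually.of_forall fun y => ?_)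
  dsimp only
  rw [← Finset.sum_smul, ← neg_smul, ← two_mul_fieldProfile_add]
  congr 1
  simp_rw [partialDeriv_fieldComp]
  rw [Fin.sum_univ_two]
  have hn : ‖x - y‖ ^ 2 = (x - y) 0 ^ 2 + (x - y) 1 ^ 2 := by
    rw [EuclideanSpace.real_norm_sq_eq, Fin.sum_univ_two]
  generalize deriv (fieldProfile ε) (‖x - y‖ ^ 2) = d
  rw [hn]
  ring

/-- Potential estimate: a function with a weak gradient is dominated almost everywhere by the
truncated Riesz potential of order one of the sum of the norms of the function and its gradient. -/
theorem exists_enorm_le_lintegral_truncKernel : ∃ C : ℝ, 0 < C ∧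
    ∀ (V : Type) [NormedAddCommGroup V] [InnerProductSpace ℝ V] [FiniteDimensional ℝ V]
      (u : Plane → V) (g : Fin 2 → Plane → V), (∀ i, IsWeakPartial planeProj i u (g i)) →
      ∀ᵐ x, ‖u x‖ₑ ≤ ENNReal.ofReal C *
        ∫⁻ y, truncKernel (x - y) * (‖u y‖ₑ + ∑ i, ‖g i y‖ₑ) := by
  obtain ⟨B, hB0, hB⟩ := exists_abs_radialBump_le
  refine ⟨max (2 * B) 1, by positivity, fun V _ _ _ u g h => ?_⟩
  have hu : LocallyIntegrable u volume := (h 0).locallyIntegrable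
  have hk := measurable_truncKernel
  have hum : AEMeasurable fun y => ‖u y‖ₑ := hu.aestronglyMeasurable.enorm
  have hgm : ∀ i, AEMeasurable fun y => ‖g i y‖ₑ :=
    fun i => (h i).locallyIntegrable_deriv.aestronglyMeasurable.enorm
  filter_upwards [ae_tendsto_integral_radialBump hu] with x hx
  have hr := continuous_radialBump
  -- The fixed bump is bounded and supported in `|z| ≤ 2`, where `1 ≤ 2 |z|⁻¹`.
  have bump : ∀ z : Plane, ‖radialBump (‖z‖ ^ 2)‖ₑ ≤ ENNReal.ofReal (2 * B) * truncKernel z := by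
    intro z
    rcases eq_or_ne z 0 with rfl | hz
    · rw [radialBump_of_lt_one (by simp)]
      simp
    have hz0 : 0 < ‖z‖ := norm_pos_iff.2 hz
    by_cases h2 : ‖z‖ ≤ 2
    · rw [truncKernel, if_pos h2, ← ENNReal.ofReal_mul (by positivity), Real.enorm_eq_ofReal_abs]
      apply ENNReal.ofReal_le_ofReal
      refine (hB _).trans ?_
      rw [← div_eq_mul_inv, le_div_iff₀ hz0]
      nlinarith
    · rw [radialBump_of_two_lt (by nlinarith)]
      simp
  have bound : ∀ δ ∈ Ioc (0 : ℝ) 1,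
      ‖∫ y, ((δ ^ 2)⁻¹ * radialBump ((δ ^ 2)⁻¹ * ‖x - y‖ ^ 2)) • u y‖ₑ
        ≤ ENNReal.ofReal (max (2 * B) 1) *
          ∫⁻ y, truncKernel (x - y) * (‖u y‖ₑ + ∑ i, ‖g i y‖ₑ) := by
    rintro δ ⟨hδ, hδ1⟩
    have hsupp : ∀ ε : ℝ, 0 < ε → ε ≤ 1 →
        HasCompactSupport fun y : Plane => ε⁻¹ * radialBump (ε⁻¹ * ‖x - y‖ ^ 2) := by
      intro ε hε hε1
      refine HasCompactSupport.intro (isCompact_closedBall x 2) fun y hy => ?_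
      rw [Metric.mem_closedBall, not_le, dist_comm, dist_eq_norm] at hy
      have h1 : ‖x - y‖ ^ 2 ≤ ε⁻¹ * ‖x - y‖ ^ 2 :=
        le_mul_of_one_le_left (by positivity) ((one_le_inv₀ hε).2 hε1)
      rw [radialBump_of_two_lt (by nlinarith), mul_zero]
    have hint : ∀ ε : ℝ, 0 < ε → ε ≤ 1 →
        Integrable fun y : Plane => (ε⁻¹ * radialBump (ε⁻¹ * ‖x - y‖ ^ 2)) • u y :=
      fun ε hε hε1 => hu.integrable_smul_left_of_hasCompactSupport (by fun_prop) (hsupp ε hε hε1)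
    have hint1 : Integrable fun y : Plane => radialBump (‖x - y‖ ^ 2) • u y := by
      simpa using hint 1 one_pos le_rfl
    have hδ2 : 0 < δ ^ 2 := by positivity
    have hδ3 : δ ^ 2 ≤ 1 := pow_le_one₀ hδ.le hδ1
    have heq := integral_radialBump_eq h hδ2 hδ3 x
    simp_rw [sub_smul] at heq
    rw [integral_sub (hint _ hδ2 hδ3) hint1, sub_eq_iff_eq_add] at heq
    rw [heq]
    calc ‖(∑ i, ∫ y, fieldComp (δ ^ 2) i (x - y) • g i y) + ∫ y, radialBump (‖x - y‖ ^ 2) • u y‖ₑ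
        ≤ (∑ i, ∫⁻ y, ‖fieldComp (δ ^ 2) i (x - y) • g i y‖ₑ)
            + ∫⁻ y, ‖radialBump (‖x - y‖ ^ 2) • u y‖ₑ := by
          refine (enorm_add_le _ _).trans ?_
          gcongr
          · refine (enorm_sum_le _ _).trans (Finset.sum_le_sum fun i _ => ?_)
            exact enorm_integral_le_lintegral_enorm _
          · exact enorm_integral_le_lintegral_enorm _
      _ ≤ (∑ i, ∫⁻ y, truncKernel (x - y) * ‖g i y‖ₑ)
            + ENNReal.ofReal (2 * B) * ∫⁻ y, truncKernel (x - y) * ‖u y‖ₑ := by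
          rw [← lintegral_const_mul' _ _ ENNReal.ofReal_ne_top]
          refine add_le_add (Finset.sum_le_sum fun i _ => lintegral_mono fun y => ?_)
            (lintegral_mono fun y => ?_)
          · dsimp only
            rw [enorm_smul]
            gcongr
            exact enorm_fieldComp_le hδ2 hδ3 i _
          · dsimp only
            rw [enorm_smul, ← mul_assoc]
            gcongr
            exact bump _
      _ ≤ ENNReal.ofReal (max (2 * B) 1) * (∑ i, ∫⁻ y, truncKernel (x - y) * ‖g i y‖ₑ)
            + ENNReal.ofReal (max (2 * B) 1) * ∫⁻ y, truncKernel (x - y) * ‖u y‖ₑ := by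
          gcongr
          · refine le_mul_of_one_le_left (by positivity) ?_
            rw [ENNReal.one_le_ofReal]
            exact le_max_right _ _
          · exact le_max_left _ _
      _ = _ := by
          rw [← mul_add, ← lintegral_finsetSum' _ fun i _ => by fun_prop,
            ← lintegral_add_left' (by fun_prop)]
          congr 1
          refine lintegral_congr fun y => ?_
          rw [← Finset.mul_sum, ← mul_add, add_comm]
  have hlim := le_of_tendsto hx.enorm (by
    filter_upwards [Ioc_mem_nhdsGT (zero_lt_one' ℝ)] with δ hδ using bound δ hδ)
  refine le_trans ?_ hlim
  rw [enorm_smul]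
  refine le_mul_of_one_le_left (by positivity) ?_
  rw [Real.enorm_eq_ofReal (by positivity), ENNReal.one_le_ofReal]
  linarith [Real.pi_gt_three]

end

/-! ### Lifting from the torus to the plane -/

section Torus

variable {L : ℝ}

/-- The period lattice `(Lℤ)²` of the torus. -/
abbrev periodLattice (L : ℝ) : AddSubgroup Plane := (torusProj L).ker

theorem mem_periodLattice {v : Plane} : v ∈ periodLattice L ↔ ∀ i, ∃ n : ℤ, n • L = v i := by
  rw [AddMonoidHom.mem_ker, funext_iff]
  refine forall_congr' fun i => ?_
  exact AddCircle.coe_eq_zero_iff L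

theorem torusProj_vadd (v : periodLattice L) (y : Plane) :
    torusProj L (v +ᵥ y) = torusProj L y := by
  rw [AddSubgroup.vadd_def, vadd_eq_add, map_add, AddMonoidHom.mem_ker.1 v.2, zero_add]

theorem finite_periodLattice_norm_le [hL : Fact (0 < L)] (R : ℝ) :
    {v : periodLattice L | ‖(v : Plane)‖ ≤ R}.Finite := by
  have hL0 := hL.out
  obtain ⟨N, hN⟩ := exists_nat_ge (R / L)
  have hfin : ((fun n : Fin 2 → ℤ => (WithLp.toLp 2 fun i => n i • L : Plane)) ''
      (Set.univ.pi fun _ => Set.Icc (-(N : ℤ)) N)).Finite :=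
    (Set.Finite.pi fun _ => Set.finite_Icc _ _).image _
  refine Set.Finite.of_finite_image (f := Subtype.val) (hfin.subset ?_)
    Subtype.val_injective.injOn
  rintro _ ⟨v, hv, rfl⟩
  choose n hn using mem_periodLattice.1 v.2
  refine ⟨n, fun i _ => ?_, ?_⟩
  · have h1 : |(v : Plane) i| ≤ R := by
      have := PiLp.norm_apply_le (v : Plane) i
      exact (by simpa using this : |(v : Plane) i| ≤ ‖(v : Plane)‖).trans hv
    rw [← hn i, zsmul_eq_mul, abs_mul, abs_of_pos hL0, ← le_div_iff₀ hL0] at h1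
    have h2 : |n i| ≤ (N : ℤ) := by exact_mod_cast h1.trans hN
    exact abs_le.1 h2
  · ext i
    exact hn i

instance countable_periodLattice : Countable (periodLattice L) := by
  have h : (periodLattice L : Set Plane) ⊆
      Set.range fun n : Fin 2 → ℤ => (WithLp.toLp 2 fun i => n i • L : Plane) := by
    intro v hv
    choose n hn using mem_periodLattice.1 hv
    exact ⟨n, by ext i; exact hn i⟩
  exact ((Set.countable_range _).mono h).to_subtype

/-- The half-open cell `(0, L]²`, a fundamental domain of `periodLattice L`. The upper end is
written `0 + L` to match `AddCircle.measurePreserving_mk`. -/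
def periodCell (L : ℝ) : Set Plane := {y | ∀ i, y i ∈ Ioc (0 : ℝ) (0 + L)}

theorem measurableSet_periodCell : MeasurableSet (periodCell L) := by
  have : periodCell L = ⋂ i, {y : Plane | y i ∈ Ioc (0 : ℝ) (0 + L)} := by
    ext y
    simp [periodCell]
  rw [this]
  exact MeasurableSet.iInter fun i => measurableSet_Ioc.preimage (by fun_prop)

theorem norm_le_of_mem_periodCell {y : Plane} (hy : y ∈ periodCell L) : ‖y‖ ≤ 2 * L := by
  have h0 := hy 0
  have h1 := hy 1
  simp only [zero_add, mem_Ioc] at h0 h1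
  refine abs_le_of_sq_le_sq' ?_ (by linarith) |>.2
  rw [EuclideanSpace.real_norm_sq_eq, Fin.sum_univ_two]
  nlinarith

theorem isAddFundamentalDomain_periodCell [hL : Fact (0 < L)] :
    IsAddFundamentalDomain (periodLattice L) (periodCell L) volume := by
  refine IsAddFundamentalDomain.mk' measurableSet_periodCell.nullMeasurableSet fun x => ?_
  choose n hn hn' using fun i => existsUnique_add_zsmul_mem_Ioc hL.out (x i) 0
  refine ⟨⟨WithLp.toLp 2 fun i => n i • L, mem_periodLattice.2 fun i => ⟨n i, rfl⟩⟩,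
    fun i => ?_, fun v hv => ?_⟩
  · rw [AddSubgroup.vadd_def, vadd_eq_add, add_comm _ x]
    exact hn i
  · ext i
    obtain ⟨m, hm⟩ := mem_periodLattice.1 v.2 i
    have h := hv i
    rw [AddSubgroup.vadd_def, vadd_eq_add, add_comm _ x, PiLp.add_apply, ← hm] at h
    rw [← hm]
    exact congrArg (· • L) (hn' i m h)

theorem measurable_torusProj : Measurable (torusProj L) := by
  refine measurable_pi_lambda _ fun i => ?_
  exact AddCircle.measurable_mk'.comp (by fun_prop : Measurable fun y : Plane => y i)

theorem measurePreserving_torusProj [hL : Fact (0 < L)] :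
    MeasurePreserving (torusProj L) (volume.restrict (periodCell L)) volume := by
  have h1 : MeasurePreserving (fun (a : Fin 2 → ℝ) i => ((a i : ℝ) : AddCircle L))
      (Measure.pi fun _ => volume.restrict (Ioc (0 : ℝ) (0 + L))) volume :=
    measurePreserving_pi _ _ fun _ => AddCircle.measurePreserving_mk L 0
  rw [← Measure.restrict_pi_pi] at h1
  have h2 := (PiLp.volume_preserving_ofLp (Fin 2)).restrict_preimage
    (s := Set.univ.pi fun _ : Fin 2 => Ioc (0 : ℝ) (0 + L))
    (MeasurableSet.univ_pi fun _ => measurableSet_Ioc)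
  have h3 : (@WithLp.ofLp 2 (Fin 2 → ℝ)) ⁻¹' (Set.univ.pi fun _ => Ioc (0 : ℝ) (0 + L))
      = periodCell L := by
    ext y
    simp [periodCell]
  rw [h3] at h2
  exact h1.comp h2

theorem quasiMeasurePreserving_torusProj [hL : Fact (0 < L)] :
    Measure.QuasiMeasurePreserving (torusProj L) volume volume := by
  refine ⟨measurable_torusProj, Measure.AbsolutelyContinuous.mk fun s hs h0 => ?_⟩
  rw [Measure.map_apply measurable_torusProj hs]
  refine (isAddFundamentalDomain_periodCell (L := L)).measure_zero_of_invariant _ (fun v => ?_) ?_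
  · ext y
    rw [Set.mem_vadd_set_iff_neg_vadd_mem, mem_preimage, mem_preimage, torusProj_vadd]
  · rw [← Measure.restrict_apply (measurable_torusProj hs),
      (measurePreserving_torusProj (L := L)).measure_preimage hs.nullMeasurableSet, h0]

theorem exists_finset_periodLattice [hL : Fact (0 < L)] (R D : ℝ) :
    ∃ S : Finset (periodLattice L), ∀ y : Plane, ‖y‖ ≤ D → ∀ v ∉ S, R < ‖v +ᵥ y‖ := by
  refine ⟨(finite_periodLattice_norm_le (L := L) (R + D)).toFinset, fun y hy v hv => ?_⟩
  rw [Set.Finite.mem_toFinset, mem_ofPred_eq, not_le] at hv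
  rw [AddSubgroup.vadd_def, vadd_eq_add]
  have := norm_sub_le ((v : Plane) + y) y
  rw [add_sub_cancel_right] at this
  linarith

theorem lintegral_flatTorus [hL : Fact (0 < L)] {F : FlatTorus L → ℝ≥0∞} (hF : AEMeasurable F) :
    ∫⁻ x, F x = ∫⁻ y in periodCell L, F (torusProj L y) := by
  rw [← (measurePreserving_torusProj (L := L)).map_eq] at hF ⊢
  rw [lintegral_map' hF measurable_torusProj.aemeasurable]

/-- A ball meets finitely many translates of the cell, so the integral of a periodic function over
it is at most a multiple of the integral over the torus. -/
theorem exists_setLIntegral_torusProj_le [hL : Fact (0 < L)] (R : ℝ) :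
    ∃ N : ℕ, ∀ F : FlatTorus L → ℝ≥0∞, AEMeasurable F →
      ∫⁻ y in Metric.closedBall (0 : Plane) R, F (torusProj L y) ≤ N * ∫⁻ x, F x := by
  obtain ⟨S, hS⟩ := exists_finset_periodLattice (L := L) R (2 * L)
  refine ⟨S.card, fun F hF => ?_⟩
  rw [← lintegral_indicator Metric.isClosed_closedBall.measurableSet,
    (isAddFundamentalDomain_periodCell (L := L)).lintegral_eq_tsum'', tsum_eq_sum (s := S)]
  · rw [lintegral_flatTorus hF, ← nsmul_eq_mul]
    refine Finset.sum_le_card_nsmul _ _ _ fun v _ => ?_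
    refine lintegral_mono fun y => ?_
    refine (indicator_le_self _ _ _).trans ?_
    rw [torusProj_vadd]
  · intro v hv
    rw [setLIntegral_congr_fun (g := fun _ => 0) measurableSet_periodCell, lintegral_zero]
    intro y hy
    refine indicator_of_notMem ?_ _
    rw [mem_closedBall_zero_iff, not_le]
    exact hS y (norm_le_of_mem_periodCell hy) v hv

/-- The representative in `periodCell L` of a point of the torus. -/
noncomputable def torusSection (L : ℝ) [Fact (0 < L)] (x : FlatTorus L) : Plane :=
  WithLp.toLp 2 fun i => (AddCircle.equivIoc L 0 (x i) : ℝ)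

theorem torusProj_torusSection [Fact (0 < L)] (x : FlatTorus L) :
    torusProj L (torusSection L x) = x := by
  funext i
  exact (AddCircle.equivIoc L 0).symm_apply_apply (x i)

theorem torusSection_mem_periodCell [Fact (0 < L)] (x : FlatTorus L) :
    torusSection L x ∈ periodCell L := fun i => (AddCircle.equivIoc L 0 (x i)).2

theorem measurable_torusSection [Fact (0 < L)] : Measurable (torusSection L) := by
  refine (WithLp.measurable_toLp 2 (Fin 2 → ℝ)).comp (measurable_pi_lambda _ fun i => ?_)
  exact measurable_subtype_coe.comp
    ((AddCircle.measurableEquivIoc L 0).measurable.comp (measurable_pi_apply i))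

/-- The periodization `∑ ψ(v + ·)` over `v ∈ (Lℤ)²`, as a function on the torus. By
`periodize_torusProj` it does not depend on the section used to define it. -/
noncomputable def periodize (L : ℝ) [Fact (0 < L)] (ψ : Plane → ℝ) (x : FlatTorus L) : ℝ :=
  ∑' v : periodLattice L, ψ (v +ᵥ torusSection L x)

theorem periodize_torusProj [Fact (0 < L)] (ψ : Plane → ℝ) (y : Plane) :
    periodize L ψ (torusProj L y) = ∑' v : periodLattice L, ψ (v +ᵥ y) := by
  have hw : torusSection L (torusProj L y) - y ∈ periodLattice L := by
    rw [AddMonoidHom.mem_ker, map_sub, torusProj_torusSection, sub_self]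
  rw [periodize, ← (Equiv.addRight (⟨_, hw⟩ : periodLattice L)).tsum_eq
    (fun v : periodLattice L => ψ (v +ᵥ y))]
  refine tsum_congr fun v => ?_
  simp only [Equiv.coe_addRight, AddSubgroup.vadd_def, vadd_eq_add, AddSubgroup.coe_add]
  congr 1
  abel

theorem exists_norm_bound_of_hasCompactSupport {ψ : Plane → ℝ} (hψ : HasCompactSupport ψ) :
    ∃ R, ∀ y, R < ‖y‖ → ψ y = 0 := by
  obtain ⟨R, hR⟩ := hψ.isCompact.isBounded.exists_norm_le
  refine ⟨R, fun y hy => ?_⟩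
  by_contra h
  exact absurd (hR y (subset_tsupport _ h)) (not_le.2 hy)

/-- On bounded sets the periodization of a compactly supported function is a finite sum, with the
same terms everywhere. -/
theorem exists_finset_periodize [Fact (0 < L)] {ψ : Plane → ℝ} (hψ : HasCompactSupport ψ) (D : ℝ) :
    ∃ S : Finset (periodLattice L), (∀ y : Plane, ‖y‖ ≤ D → ∀ v ∉ S, ψ (v +ᵥ y) = 0) ∧
      ∀ y : Plane, ‖y‖ ≤ D → periodize L ψ (torusProj L y) = ∑ v ∈ S, ψ (v +ᵥ y) := by
  obtain ⟨R, hR⟩ := exists_norm_bound_of_hasCompactSupport hψ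
  obtain ⟨S, hS⟩ := exists_finset_periodLattice (L := L) R D
  have h : ∀ y : Plane, ‖y‖ ≤ D → ∀ v ∉ S, ψ (v +ᵥ y) = 0 :=
    fun y hy v hv => hR _ (hS y hy v hv)
  exact ⟨S, h, fun y hy => by rw [periodize_torusProj, tsum_eq_sum (h y hy)]⟩

theorem isTestFunction_periodize [hL : Fact (0 < L)] {η : Plane → ℝ}
    (hη : IsTestFunction planeProj η) : IsTestFunction (torusProj L) (periodize L η) where
  smooth := by
    have hs : ContDiff ℝ ∞ η := hη.smooth
    rw [contDiff_iff_contDiffAt]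
    intro y₀
    obtain ⟨S, -, hS⟩ := exists_finset_periodize (L := L) hη.compactSupport (‖y₀‖ + 1)
    have hsum : ContDiff ℝ ∞ fun y => ∑ v ∈ S, η (v +ᵥ y) := by
      refine ContDiff.sum fun v _ => hs.comp ?_
      exact contDiff_const.add contDiff_id
    refine hsum.contDiffAt.congr_of_eventuallyEq ?_
    filter_upwards [Metric.ball_mem_nhds y₀ one_pos] with y hy
    refine hS y ?_
    rw [mem_ball_iff_norm] at hy
    linarith [norm_le_norm_add_norm_sub' y y₀]
  compactSupport := HasCompactSupport.of_compactSpace _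

theorem partialDeriv_periodize [hL : Fact (0 < L)] {η : Plane → ℝ}
    (hη : IsTestFunction planeProj η) (i : Fin 2) :
    partialDeriv (torusProj L) i (periodize L η)
      = periodize L (partialDeriv planeProj i η) := by
  have hs : ContDiff ℝ ∞ η := hη.smooth
  funext x
  obtain ⟨y, rfl⟩ : ∃ y, torusProj L y = x := ⟨_, torusProj_torusSection x⟩
  obtain ⟨R, hR⟩ := exists_norm_bound_of_hasCompactSupport hη.compactSupport
  obtain ⟨R', hR'⟩ := exists_norm_bound_of_hasCompactSupport
    (continuous_partialDeriv_plane hη i).2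
  obtain ⟨S, hS⟩ := exists_finset_periodLattice (L := L) (max R R') (‖y‖ + 1)
  have h1 : (fun s : ℝ => periodize L η (torusProj L y + torusProj L (EuclideanSpace.single i s)))
      =ᶠ[nhds 0] fun s => ∑ v ∈ S, η ((v +ᵥ y) + planeProj (EuclideanSpace.single i s)) := by
    filter_upwards [Metric.ball_mem_nhds (0 : ℝ) one_pos] with s hs1
    rw [← map_add, periodize_torusProj, tsum_eq_sum (s := S)]
    · refine Finset.sum_congr rfl fun v _ => ?_
      rw [AddSubgroup.vadd_def, vadd_eq_add, AddSubgroup.vadd_def, vadd_eq_add, add_assoc]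
      rfl
    · intro v hv
      refine hR _ ((le_max_left _ _).trans_lt (hS _ ?_ v hv))
      refine (norm_add_le _ _).trans ?_
      rw [mem_ball_zero_iff] at hs1
      simpa using hs1.le
  rw [partialDeriv, h1.deriv_eq, periodize_torusProj, tsum_eq_sum (s := S)]
  · rw [deriv_fun_sum]
    · rfl
    · intro v _
      have h2 : DifferentiableAt ℝ (fun s : ℝ =>
          (v +ᵥ y) + planeProj (EuclideanSpace.single i s)) 0 := by
        refine (differentiableAt_const _).add ?_
        simp_rw [planeProj_single]
        exact differentiableAt_id.smul_const _
      exact (hs.differentiable (by simp) _).comp (0 : ℝ) h2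
  · intro v hv
    exact hR' _ ((le_max_right _ _).trans_lt (hS _ (by linarith) v hv))

theorem locallyIntegrable_comp_torusProj [hL : Fact (0 < L)] {V : Type} [NormedAddCommGroup V]
    {h : FlatTorus L → V}
    (hh : LocallyIntegrable h volume) :
    LocallyIntegrable (fun y => h (torusProj L y)) volume := by
  have hm : AEStronglyMeasurable (fun y => h (torusProj L y)) volume :=
    hh.aestronglyMeasurable.comp_quasiMeasurePreserving quasiMeasurePreserving_torusProj
  have hfin : ∫⁻ x, ‖h x‖ₑ < ⊤ := by
    have := hh.integrableOn_isCompact isCompact_univ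
    rw [integrableOn_univ] at this
    exact this.2
  rw [locallyIntegrable_iff]
  intro K hK
  obtain ⟨R, hR⟩ := hK.isBounded.subset_closedBall (0 : Plane)
  refine IntegrableOn.mono_set ⟨hm.restrict, ?_⟩ hR
  obtain ⟨N, hN⟩ := exists_setLIntegral_torusProj_le (L := L) R
  exact (hN (fun x => ‖h x‖ₑ) hh.aestronglyMeasurable.enorm).trans_lt
    (ENNReal.mul_lt_top (by simp) hfin)

variable {V : Type} [NormedAddCommGroup V] [InnerProductSpace ℝ V]

/-- Unfolding: integrals over the torus against a periodization are integrals over the plane. -/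
theorem integral_periodize_smul [hL : Fact (0 < L)] {ψ : Plane → ℝ} (hc : Continuous ψ)
    (hψ : HasCompactSupport ψ) {h : FlatTorus L → V} (hh : LocallyIntegrable h volume) :
    ∫ x, periodize L ψ x • h x = ∫ y, ψ y • h (torusProj L y) := by
  have hhl := locallyIntegrable_comp_torusProj hh
  obtain ⟨S, hS0, hS⟩ := exists_finset_periodize (L := L) hψ (2 * L)
  have hper : Measurable (periodize L ψ) := by
    have : periodize L ψ = fun x => ∑ v ∈ S, ψ (v +ᵥ torusSection L x) := by
      funext x
      conv_lhs => rw [← torusProj_torusSection x]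
      exact hS _ (norm_le_of_mem_periodCell (torusSection_mem_periodCell x))
    rw [this]
    refine Finset.measurable_sum _ fun v _ => hc.measurable.comp ?_
    exact measurable_torusSection.const_add (v : Plane)
  have hint : Integrable fun y => ψ y • h (torusProj L y) :=
    hhl.integrable_smul_left_of_hasCompactSupport hc hψ
  have hm : AEStronglyMeasurable (fun x => periodize L ψ x • h x) volume :=
    hper.aestronglyMeasurable.smul hh.aestronglyMeasurable
  rw [(isAddFundamentalDomain_periodCell (L := L)).integral_eq_tsum'' _ hint, tsum_eq_sum (s := S)]
  · rw [← (measurePreserving_torusProj (L := L)).map_eq] at hm ⊢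
    rw [integral_map measurable_torusProj.aemeasurable hm, ← integral_finsetSum]
    · refine setIntegral_congr_fun measurableSet_periodCell fun y hy => ?_
      rw [hS y (norm_le_of_mem_periodCell hy), Finset.sum_smul]
      refine Finset.sum_congr rfl fun v _ => ?_
      rw [torusProj_vadd]
    · intro v _
      exact (hint.comp_add_left (v : Plane)).integrableOn
  · intro v hv
    rw [setIntegral_congr_fun (g := fun _ => 0) measurableSet_periodCell, integral_zero]
    intro y hy
    dsimp only
    rw [hS0 y (norm_le_of_mem_periodCell hy) v hv, zero_smul]

/-- The lift of a weak partial derivative is a weak partial derivative on the plane, since test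
functions on the plane periodize to test functions on the torus. -/
theorem IsWeakPartial.comp_torusProj [hL : Fact (0 < L)] {u g : FlatTorus L → V} {i : Fin 2}
    (h : IsWeakPartial (torusProj L) i u g) :
    IsWeakPartial planeProj i (fun y => u (torusProj L y)) (fun y => g (torusProj L y)) where
  locallyIntegrable := locallyIntegrable_comp_torusProj h.locallyIntegrable
  locallyIntegrable_deriv := locallyIntegrable_comp_torusProj h.locallyIntegrable_deriv
  integral_eq η hη := by
    obtain ⟨hc, hs⟩ := continuous_partialDeriv_plane hη i
    have hηc : ContDiff ℝ ∞ η := hη.smooth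
    rw [← integral_periodize_smul hc hs h.locallyIntegrable,
      ← integral_periodize_smul hηc.continuous hη.compactSupport h.locallyIntegrable_deriv,
      ← partialDeriv_periodize hη]
    exact h.integral_eq _ (isTestFunction_periodize hη)

end Torus

/-! ### The weighted inequality -/

theorem sq_add_sum_fin_two_le (a : ℝ≥0∞) (b : Fin 2 → ℝ≥0∞) :
    (a + ∑ i, b i) ^ 2 ≤ 3 * (a ^ 2 + ∑ i, b i ^ 2) := by
  rw [Fin.sum_univ_two, Fin.sum_univ_two]
  have h1 := ENNReal.two_mul_mul_le_sq_add_sq a (b 0)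
  have h2 := ENNReal.two_mul_mul_le_sq_add_sq a (b 1)
  have h3 := ENNReal.two_mul_mul_le_sq_add_sq (b 0) (b 1)
  calc (a + (b 0 + b 1)) ^ 2
      = a ^ 2 + b 0 ^ 2 + b 1 ^ 2 + (2 * (a * b 0) + 2 * (a * b 1) + 2 * (b 0 * b 1)) := by ring
    _ ≤ a ^ 2 + b 0 ^ 2 + b 1 ^ 2 +
        ((a ^ 2 + b 0 ^ 2) + (a ^ 2 + b 1 ^ 2) + (b 0 ^ 2 + b 1 ^ 2)) := by gcongr
    _ = _ := by ring

theorem lintegral_sq_add_sum_le {X : Type} [MeasureSpace X] {a : X → ℝ≥0∞}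
    {b : Fin 2 → X → ℝ≥0∞} (ha : AEMeasurable a) (hb : ∀ i, AEMeasurable (b i)) :
    ∫⁻ x, (a x + ∑ i, b i x) ^ 2 ≤ 3 * ((∫⁻ x, a x ^ 2) + ∑ i, ∫⁻ x, b i x ^ 2) := by
  calc ∫⁻ x, (a x + ∑ i, b i x) ^ 2 ≤ ∫⁻ x, 3 * (a x ^ 2 + ∑ i, b i x ^ 2) :=
        lintegral_mono fun x => sq_add_sum_fin_two_le _ _
    _ = _ := by
        rw [lintegral_const_mul' _ _ (by simp), lintegral_add_left' (by fun_prop),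
          lintegral_finsetSum' _ fun i _ => (hb i).pow_const 2]

/-- The weighted estimate at a fixed time on the plane. The set `s` localizes it: only
the values of `u` and `g` near the points where `q` is nonzero enter the right-hand side. -/
theorem exists_lintegral_weight_mul_sq_le : ∃ C : ℝ, 0 < C ∧
    ∀ (V : Type) [NormedAddCommGroup V] [InnerProductSpace ℝ V] [FiniteDimensional ℝ V]
      (u : Plane → V) (g : Fin 2 → Plane → V) (q : Plane → ℝ) (s : Set Plane),
      (∀ i, IsWeakPartial planeProj i u (g i)) → AEMeasurable q →
      ∫⁻ x, ENNReal.ofReal (q x) = 1 → absEntropy q ≠ ⊤ → MeasurableSet s →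
      (∀ x, q x ≠ 0 → Metric.closedBall x 2 ⊆ s) →
      ∫⁻ x, ENNReal.ofReal (q x) * ‖u x‖ₑ ^ 2 ≤ ENNReal.ofReal C * (1 + absEntropy q) *
        ∫⁻ y in s, (‖u y‖ₑ + ∑ i, ‖g i y‖ₑ) ^ 2 := by
  obtain ⟨C, hC, hpot⟩ := exists_enorm_le_lintegral_truncKernel
  have hpi := Real.pi_pos
  refine ⟨C ^ 2 * (4 * Real.pi * (32 * Real.pi)), by positivity,
    fun V _ _ _ u g q s hg hq hq1 hent hs hsupp => ?_⟩
  set f : Plane → ℝ≥0∞ := fun y => ‖u y‖ₑ + ∑ i, ‖g i y‖ₑ with hf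
  have hum : AEMeasurable fun y => ‖u y‖ₑ := (hg 0).locallyIntegrable.aestronglyMeasurable.enorm
  have hgm : ∀ i, AEMeasurable fun y => ‖g i y‖ₑ :=
    fun i => (hg i).locallyIntegrable_deriv.aestronglyMeasurable.enorm
  have hfm : AEMeasurable f := hum.add (Finset.aemeasurable_fun_sum _ fun i _ => hgm i)
  have hloc : ∀ x, q x ≠ 0 → ∫⁻ y, truncKernel (x - y) * f y
      = ∫⁻ y, truncKernel (x - y) * s.indicator f y := by
    intro x hx
    refine lintegral_congr fun y => ?_
    by_cases hy : y ∈ s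
    · rw [indicator_of_mem hy]
    · have h2 : ¬ ‖x - y‖ ≤ 2 := by
        intro h
        exact hy (hsupp x hx (by rwa [Metric.mem_closedBall, dist_comm, dist_eq_norm]))
      rw [truncKernel, if_neg h2, zero_mul, zero_mul]
  have h32 : (1 : ℝ≥0∞) ≤ ENNReal.ofReal (32 * Real.pi) := by
    rw [ENNReal.one_le_ofReal]
    linarith [Real.pi_gt_three]
  calc ∫⁻ x, ENNReal.ofReal (q x) * ‖u x‖ₑ ^ 2
      ≤ ∫⁻ x, ENNReal.ofReal C ^ 2 *
          (ENNReal.ofReal (q x) * (∫⁻ y, truncKernel (x - y) * s.indicator f y) ^ 2) := by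
        refine lintegral_mono_ae ?_
        filter_upwards [hpot V u g hg] with x hx
        rcases eq_or_ne (q x) 0 with h0 | h0
        · simp [h0]
        rw [← hloc x h0]
        calc ENNReal.ofReal (q x) * ‖u x‖ₑ ^ 2
            ≤ ENNReal.ofReal (q x) *
                (ENNReal.ofReal C * ∫⁻ y, truncKernel (x - y) * f y) ^ 2 := by gcongr
          _ = _ := by ring
    _ = ENNReal.ofReal C ^ 2 * ∫⁻ x, ENNReal.ofReal (q x) *
          (∫⁻ y, truncKernel (x - y) * s.indicator f y) ^ 2 :=
        lintegral_const_mul' _ _ (by simp)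
    _ ≤ ENNReal.ofReal C ^ 2 * (ENNReal.ofReal (4 * Real.pi) *
          (absEntropy q + ENNReal.ofReal (32 * Real.pi)) * ∫⁻ y, s.indicator f y ^ 2) := by
        gcongr
        exact lintegral_mul_sq_truncKernel_le hq (by simp [hq1]) hent (hfm.indicator hs)
    _ ≤ ENNReal.ofReal C ^ 2 * (ENNReal.ofReal (4 * Real.pi) *
          (ENNReal.ofReal (32 * Real.pi) * (1 + absEntropy q)) * ∫⁻ y in s, f y ^ 2) := by
        have hind : ∀ y, s.indicator f y ^ 2 = s.indicator (fun y => f y ^ 2) y := by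
          intro y
          by_cases hy : y ∈ s <;> simp [hy]
        rw [lintegral_congr hind, lintegral_indicator hs]
        gcongr
        rw [mul_add, mul_one, add_comm]
        gcongr
        exact le_mul_of_one_le_left (by positivity) h32
    _ = _ := by
        rw [ENNReal.ofReal_mul (p := C ^ 2) (by positivity),
          ENNReal.ofReal_mul (p := 4 * Real.pi) (by positivity),
          ENNReal.ofReal_pow hC.le]
        ring

/-- The inequality at a fixed time, with constant `C`, for the space `X` with projection `τ`, stated
for a given weak gradient `g` of `u`. -/
def WeightedBound {X : Type} [AddCommGroup X] [TopologicalSpace X] [MeasureSpace X]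
    (τ : Plane →+ X) (C : ℝ) : Prop :=
  ∀ (V : Type) [NormedAddCommGroup V] [InnerProductSpace ℝ V] [FiniteDimensional ℝ V]
    (u : X → V) (g : Fin 2 → X → V) (q : X → ℝ),
    (∀ i, IsWeakPartial τ i u (g i)) → AEMeasurable q →
    ∫⁻ x, ENNReal.ofReal (q x) = 1 → absEntropy q ≠ ⊤ →
    ∫⁻ x, ENNReal.ofReal (q x) * ‖u x‖ₑ ^ 2 ≤ ENNReal.ofReal C * (1 + absEntropy q) *
      ((∫⁻ x, ‖u x‖ₑ ^ 2) + ∑ i, ∫⁻ x, ‖g i x‖ₑ ^ 2)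

theorem exists_weightedBound_plane : ∃ C : ℝ, 0 < C ∧ WeightedBound planeProj C := by
  obtain ⟨C, hC, h⟩ := exists_lintegral_weight_mul_sq_le
  refine ⟨C * 3, by positivity, fun V _ _ _ u g q hg hq hq1 hent => ?_⟩
  refine (h V u g q univ hg hq hq1 hent MeasurableSet.univ fun _ _ => subset_univ _).trans ?_
  rw [Measure.restrict_univ]
  calc _ ≤ ENNReal.ofReal C * (1 + absEntropy q) *
        (3 * ((∫⁻ x, ‖u x‖ₑ ^ 2) + ∑ i, ∫⁻ x, ‖g i x‖ₑ ^ 2)) := by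
        gcongr
        exact lintegral_sq_add_sum_le (hg 0).locallyIntegrable.aestronglyMeasurable.enorm
          fun i => (hg i).locallyIntegrable_deriv.aestronglyMeasurable.enorm
    _ = _ := by
        rw [ENNReal.ofReal_mul hC.le, ENNReal.ofReal_ofNat]
        ring

/-- The torus reduces to the plane: `u` and `g` are lifted, and the density is lifted and restricted
to one cell, which changes neither its mass nor its entropy. -/
theorem exists_weightedBound_torus (L : ℝ) [hL : Fact (0 < L)] :
    ∃ C : ℝ, 0 < C ∧ WeightedBound (torusProj L) C := by
  obtain ⟨C, hC, h⟩ := exists_lintegral_weight_mul_sq_le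
  obtain ⟨N, hN⟩ := exists_setLIntegral_torusProj_le (L := L) (2 * L + 2)
  refine ⟨C * ((N + 1 : ℕ) * 3), by positivity, fun V _ _ _ u g q hg hq hq1 hent => ?_⟩
  have hum : AEMeasurable fun y => ‖u y‖ₑ := (hg 0).locallyIntegrable.aestronglyMeasurable.enorm
  have hgm : ∀ i, AEMeasurable fun y => ‖g i y‖ₑ :=
    fun i => (hg i).locallyIntegrable_deriv.aestronglyMeasurable.enorm
  have hfm : AEMeasurable fun y => ‖u y‖ₑ + ∑ i, ‖g i y‖ₑ :=
    hum.add (Finset.aemeasurable_fun_sum _ fun i _ => hgm i)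
  set q' : Plane → ℝ := (periodCell L).indicator fun y => q (torusProj L y) with hq'
  have hq'm : AEMeasurable q' :=
    (hq.comp_quasiMeasurePreserving quasiMeasurePreserving_torusProj).indicator
      measurableSet_periodCell
  have hcell : ∀ (G : ℝ → Plane → ℝ≥0∞), (∀ y, G 0 y = 0) →
      ∫⁻ y, G (q' y) y = ∫⁻ y in periodCell L, G (q (torusProj L y)) y := by
    intro G hG
    rw [← lintegral_indicator measurableSet_periodCell]
    refine lintegral_congr fun y => ?_
    by_cases hy : y ∈ periodCell L
    · rw [hq', indicator_of_mem hy, indicator_of_mem hy]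
    · rw [hq', indicator_of_notMem hy, indicator_of_notMem hy, hG]
  have hent' : absEntropy q' = absEntropy q := by
    rw [absEntropy, absEntropy, lintegral_flatTorus (by fun_prop),
      hcell (fun r _ => ENNReal.ofReal (r * |Real.log r|)) (by simp)]
  have hmass : ∫⁻ y, ENNReal.ofReal (q' y) = 1 := by
    rw [hcell (fun r _ => ENNReal.ofReal r) (by simp), ← hq1, lintegral_flatTorus (by fun_prop)]
  have key := h V (fun y => u (torusProj L y)) (fun i y => g i (torusProj L y)) q'
    (Metric.closedBall 0 (2 * L + 2)) (fun i => (hg i).comp_torusProj) hq'm hmass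
    (by rwa [hent']) Metric.isClosed_closedBall.measurableSet (fun x hx => by
      have hxc : x ∈ periodCell L := by
        by_contra hxc
        exact hx (indicator_of_notMem hxc _)
      refine Metric.closedBall_subset_closedBall' ?_
      rw [dist_zero_right]
      linarith [norm_le_of_mem_periodCell hxc])
  rw [hcell (fun r y => ENNReal.ofReal r * ‖u (torusProj L y)‖ₑ ^ 2) (by simp), hent'] at key
  rw [lintegral_flatTorus (by fun_prop)]
  refine key.trans ?_
  calc _ ≤ ENNReal.ofReal C * (1 + absEntropy q) *
        ((N + 1 : ℕ) * (3 * ((∫⁻ x, ‖u x‖ₑ ^ 2) + ∑ i, ∫⁻ x, ‖g i x‖ₑ ^ 2))) := by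
        gcongr
        refine (hN (fun x => (‖u x‖ₑ + ∑ i, ‖g i x‖ₑ) ^ 2) (hfm.pow_const 2)).trans ?_
        gcongr
        · exact Nat.le_succ N
        · exact lintegral_sq_add_sum_le hum hgm
    _ = _ := by
        rw [ENNReal.ofReal_mul hC.le, ENNReal.ofReal_mul (by positivity), ENNReal.ofReal_natCast,
          ENNReal.ofReal_ofNat]
        ring

/-- Integration in time of the inequality at a fixed time. -/
theorem WeightedBound.lintegral_le {X : Type} [AddCommGroup X] [TopologicalSpace X] [MeasureSpace X]
    [SFinite (volume : Measure X)] {τ : Plane →+ X} {C : ℝ} (hC : 0 < C) (h : WeightedBound τ C)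
    {V : Type} [NormedAddCommGroup V] [InnerProductSpace ℝ V] [FiniteDimensional ℝ V] {T : ℝ}
    {p : ℝ → X → ℝ} {φ : ℝ → X → V} (hp : MemLinftyProbLlogL T p) :
    (∫⁻ t in Ioo 0 T, ∫⁻ x, ENNReal.ofReal (p t x) * ‖φ t x‖ₑ ^ 2) ≤
      ENNReal.ofReal C * (1 + supAbsEntropy T p) * l2h1NormSq τ T φ := by
  have hc0 : ENNReal.ofReal C * (1 + supAbsEntropy T p) ≠ 0 := by simp [hC]
  have hct : ENNReal.ofReal C * (1 + supAbsEntropy T p) ≠ ⊤ :=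
    ENNReal.mul_ne_top ENNReal.ofReal_ne_top
      (ENNReal.add_ne_top.2 ⟨ENNReal.one_ne_top, hp.entropy_lt_top.ne⟩)
  rw [l2h1NormSq, ← lintegral_const_mul' _ _ hct]
  refine lintegral_mono_ae ?_
  filter_upwards [hp.aestronglyMeasurable.prodMk_left, hp.mass_eq_one,
    ENNReal.ae_le_essSup (μ := volume.restrict (Ioo (0 : ℝ) T)) fun t => absEntropy (p t)]
    with t hm h1 hent
  have hent' : absEntropy (p t) ≤ supAbsEntropy T p := hent
  -- Without a weak gradient the infimum is empty and the bound is `∞`.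
  rw [h1NormSq, ENNReal.mul_iInf_of_ne hc0 hct]
  refine le_iInf fun g => ?_
  rw [ENNReal.mul_iInf_of_ne hc0 hct]
  refine le_iInf fun hg => ?_
  refine (h V (φ t) g (p t) hg hm.aemeasurable h1
    (hent'.trans_lt hp.entropy_lt_top).ne).trans ?_
  gcongr

theorem lemma2p1 :
    -- the case `Ω = ℝ²`
    (∃ C : ℝ, 0 < C ∧
      ∀ (V : Type) [NormedAddCommGroup V] [InnerProductSpace ℝ V] [FiniteDimensional ℝ V]
        (T : ℝ) (_ : 0 < T) (p : ℝ → Plane → ℝ) (φ : ℝ → Plane → V),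
        MemLinftyProbLlogL T p → MemL2H1 planeProj T φ →
        (∫⁻ t in Ioo 0 T, ∫⁻ x, ENNReal.ofReal (p t x) * ‖φ t x‖ₑ ^ 2) ≤
          ENNReal.ofReal C * (1 + supAbsEntropy T p) * l2h1NormSq planeProj T φ) ∧
    -- the case `Ω = 𝕋²`, for a torus of any side length
    (∀ (L : ℝ) [Fact (0 < L)], ∃ C : ℝ, 0 < C ∧
      ∀ (V : Type) [NormedAddCommGroup V] [InnerProductSpace ℝ V] [FiniteDimensional ℝ V]
        (T : ℝ) (_ : 0 < T) (p : ℝ → FlatTorus L → ℝ) (φ : ℝ → FlatTorus L → V),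
        MemLinftyProbLlogL T p → MemL2H1 (torusProj L) T φ →
        (∫⁻ t in Ioo 0 T, ∫⁻ x, ENNReal.ofReal (p t x) * ‖φ t x‖ₑ ^ 2) ≤
          ENNReal.ofReal C * (1 + supAbsEntropy T p) * l2h1NormSq (torusProj L) T φ) := by
  constructor
  · obtain ⟨C, hC, h⟩ := exists_weightedBound_plane
    exact ⟨C, hC, fun V _ _ _ T _ p φ hp _ => h.lintegral_le hC hp⟩
  · intro L _
    obtain ⟨C, hC, h⟩ := exists_weightedBound_torus L
    exact ⟨C, hC, fun V _ _ _ T _ p φ hp _ => h.lintegral_le hC hp⟩
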